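/- All graphs are finite and simple. A \emph{plane triangulation} is a plane graph on at least three vertices all of whose faces (including the outer one) are bounded by triangles. For an integer $k\ge 3$ let $C_k$ be the cycle on $k$ vertices. A subgraph of an edge-colored graph is \emph{rainbow} if its edges have pairwise different colors. For $n\ge k$, the \emph{planar anti-Ramsey number} $ar_{\mathcal P}(n,C_k)$ is the maximum number of colors in an edge-coloring, without a rainbow copy of $C_k$, of a plane triangulation on $n$ vertices that contains $C_k$ as a subgraph. \textbf{Theorem.} Let $k\ge 5$ and $n\ge k^2-k$ be integers, and let $r$ be the remainder of $n-2$ on division by $k^2-k-2$. Then $$ar_{\mathcal P}(n,C_k)\ \ge\ \left(\frac{k-3}{k-2}+\frac{2}{3(k+1)(k-2)}\right)(3n-6)-\frac{2k^2-5k-5}{k^2-k-2}\,r .$$ -/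

import Mathlib

namespace SimpleGraph

/-- A rotation system of a graph: for every vertex `v` a cyclic order of the darts (oriented edges)
leaving `v`. The permutation `rot` sends a dart to the next dart around its initial vertex. -/
structure RotationSystem {V : Type*} (G : SimpleGraph V) where
  rot : Equiv.Perm G.Dart
  fst_rot : ∀ d : G.Dart, (rot d).fst = d.fst
  sameCycle_of_fst_eq : ∀ d e : G.Dart, d.fst = e.fst → rot.SameCycle d e

namespace RotationSystem

variable {V : Type*} {G : SimpleGraph V}

/-- The face-tracing permutation: the dart `u → v` is followed by the dart `v → w` that comes
next after `v → u` in the cyclic order around `v`. -/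
def facePerm (R : RotationSystem G) : Equiv.Perm G.Dart :=
  (Dart.symm_involutive (G := G)).toPerm.trans R.rot

/-- The faces of the embedding: the orbits of the face-tracing permutation. -/
def Face (R : RotationSystem G) : Type _ :=
  Quotient (Equiv.Perm.SameCycle.setoid R.facePerm)

/-- The size (length of the boundary walk) of the face that lies along the dart `d`. -/
noncomputable def faceSize (R : RotationSystem G) (d : G.Dart) : ℕ :=
  {e : G.Dart | R.facePerm.SameCycle d e}.ncard

/-- The rotation system of a connected finite graph with at least one edge embeds it in the sphere
(equivalently, the plane): its Euler characteristic `|V| - |E| + |F|` is `2`. -/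
def IsPlane (R : RotationSystem G) : Prop :=
  (Nat.card V : ℤ) - (G.edgeSet.ncard : ℤ) + (Nat.card R.Face : ℤ) = 2

end RotationSystem

/-- `G` is (the underlying graph of) a plane triangulation: a connected simple graph on at least
three vertices with an embedding in the plane all of whose faces, including the outer one, are
bounded by triangles. (In a simple graph a closed facial walk of length `3` is a triangle.) -/
def IsPlaneTriangulation {V : Type*} (G : SimpleGraph V) : Prop :=
  3 ≤ Nat.card V ∧ G.Connected ∧
    ∃ R : RotationSystem G, R.IsPlane ∧ ∀ d : G.Dart, R.faceSize d = 3

/-- A copy `f` of `H` in an edge-colored graph `G` is rainbow if its edges have pairwise different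
colors. -/
def IsRainbow {V W K : Type*} {G : SimpleGraph V} {H : SimpleGraph W}
    (c : G.EdgeLabeling K) (f : Copy H G) : Prop :=
  Function.Injective (c.pullback f.toHom)

/-- The numbers `m` such that some plane triangulation on `n` vertices that contains `H` as a
subgraph has an edge-coloring with exactly `m` colors and without rainbow copies of `H`. -/
def planarAntiRamseySet {W : Type*} (n : ℕ) (H : SimpleGraph W) : Set ℕ :=
  {m | ∃ T : SimpleGraph (Fin n), T.IsPlaneTriangulation ∧ H.IsContained T ∧
    ∃ c : T.EdgeLabeling (Fin m), Function.Surjective c ∧ ∀ f : Copy H T, ¬ IsRainbow c f}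

/-- The planar anti-Ramsey number `ar_P(n, H)`: the largest element of `planarAntiRamseySet n H`. -/
noncomputable def planarAntiRamsey {W : Type*} (n : ℕ) (H : SimpleGraph W) : ℕ :=
  sSup (planarAntiRamseySet n H)

/-- The supremum in `planarAntiRamsey` is over a bounded set, hence a maximum whenever that set is
nonempty. -/
theorem planarAntiRamseySet_bddAbove {W : Type*} (n : ℕ) (H : SimpleGraph W) :
    BddAbove (planarAntiRamseySet n H) := by
  refine ⟨Nat.card (Sym2 (Fin n)), ?_⟩
  rintro m ⟨T, -, -, c, hc, -⟩
  have h1 : Nat.card (Fin m) ≤ Nat.card T.edgeSet := Nat.card_le_card_of_surjective c hc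
  have h2 : Nat.card T.edgeSet ≤ Nat.card (Sym2 (Fin n)) :=
    Nat.card_le_card_of_injective _ Subtype.val_injective
  simpa using h1.trans h2

end SimpleGraph

/-! The bound is the exact number of colors of an explicit construction. Choose a set of poles in a
triangulation. Every edge that avoids the poles gets a color of its own, and every other edge gets
the color of its largest pole. A cycle through a pole is never rainbow: the two cycle edges at its
largest pole agree. So it suffices that the pole-free part contains no `C_k`, and the number of
colors is the number of pole-free edges plus the number of poles.

The pole-free part is glued from blocks, each a stacked triangulation on `k - 1` vertices with `3(k
- 3)` edges. A block is too small to contain `C_k`, and the blocks are arranged so that a cycle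
through several of them has more than `k` edges. This is the content of `Spread` and
`Spread.not_cycle`.

The layout is a bipyramid with apices `0` and `1` whose rim repeats the pattern vertex, vertex,
pole. A unit consists of two consecutive rim vertices, their triangle with `0`, and the two edges
("legs") to `1`; one more pole sits between the legs. The triangle is filled up to a block, and the
legs become chains of `a` and `b` blocks, where `a + b = k` and `b ≤ a ≤ b + 1`. The blocks of a
unit then form a ring of `k + 1`, and a ring through two units has at least `2b + 2 ≥ k + 1` blocks
(`spread_unitBlock`).

Besides the two apices a unit has `(k + 1)(k - 2)` vertices, two of them poles, and it has `3(k +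
1)(k - 3)` pole-free edges. The `r` vertices left over are added as poles. The rim pole next to a
filled triangle supplies the one vertex that its block lacks for a copy of `C_k`.

The triangulation is a finite set of oriented triangles built by two moves, inserting a vertex into
a triangle and subdividing an edge. `Frame` carries all invariants through the moves. -/

namespace PlanarAntiRamsey

/-! ### Spread families of blocks -/

/-- A family `B` of blocks with weights `W` is `k`-spread if any two vertices `u ≠ v` of a block
`B l` are at weighted distance at least `k + 1 - W l` from each other outside that block. The
distance is certified by a potential `f`. -/
def Spread (k : ℕ) (B : ℕ → Finset ℕ) (W : ℕ → ℕ) : Prop :=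
  ∀ l, ∀ u ∈ B l, ∀ v ∈ B l, u ≠ v → ∃ f : ℕ → ℤ,
    (∀ m, m ≠ l → ∀ a ∈ B m, ∀ b ∈ B m, f a ≤ f b + W m) ∧ f v + (k + 1) ≤ f u + W l

/-- Outside `B l` nothing constrains the potential at the new vertex `w`, so it may jump there by `k
+ 1`. Seen from any other block, `w` is a twin of `u` and takes over its potential. -/
theorem Spread.insert {k : ℕ} {B : ℕ → Finset ℕ} {W : ℕ → ℕ} (h : Spread k B W) {l u w : ℕ}
    (hu : u ∈ B l) (hw : ∀ m, w ∉ B m) :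
    Spread k (Function.update B l (insert w (B l))) W := by
  intro m p hp q hq hpq
  by_cases hm : m = l
  · subst hm
    simp only [Function.update_self, Finset.mem_insert] at hp hq
    by_cases hpw : p = w
    · refine ⟨fun z => if z = w then k + 1 else 0, ?_, ?_⟩
      · intro m' hm' a ha b hb
        simp only [Function.update_of_ne hm'] at ha hb
        have : a ≠ w := fun h => hw m' (h ▸ ha)
        have : b ≠ w := fun h => hw m' (h ▸ hb)
        simp [*]
      · have : q ≠ w := fun h => hpq (hpw.trans h.symm)
        simp [*]
    by_cases hqw : q = w
    · refine ⟨fun z => if z = w then -(k + 1) else 0, ?_, ?_⟩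
      · intro m' hm' a ha b hb
        simp only [Function.update_of_ne hm'] at ha hb
        have : a ≠ w := fun h => hw m' (h ▸ ha)
        have : b ≠ w := fun h => hw m' (h ▸ hb)
        simp [*]
      · simp [*]
    obtain ⟨f, hf, hg⟩ := h m p (hp.resolve_left hpw) q (hq.resolve_left hqw) hpq
    refine ⟨f, fun m' hm' a ha b hb => ?_, hg⟩
    simp only [Function.update_of_ne hm'] at ha hb
    exact hf m' hm' a ha b hb
  · simp only [Function.update_of_ne hm] at hp hq
    obtain ⟨f, hf, hg⟩ := h m p hp q hq hpq
    have hpw : p ≠ w := fun h => hw m (h ▸ hp)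
    have hqw : q ≠ w := fun h => hw m (h ▸ hq)
    refine ⟨Function.update f w (f u), fun m' hm' a ha b hb => ?_, by simpa [hpw, hqw] using hg⟩
    by_cases hml : m' = l
    · subst hml
      simp only [Function.update_self, Finset.mem_insert] at ha hb
      by_cases haw : a = w <;> by_cases hbw : b = w
      · simp [haw, hbw]
      · simpa [haw, hbw] using hf m' hm' u hu b (hb.resolve_left hbw)
      · simpa [haw, hbw] using hf m' hm' a (ha.resolve_left haw) u hu
      · simpa [haw, hbw] using hf m' hm' a (ha.resolve_left haw) b (hb.resolve_left hbw)
    · simp only [Function.update_of_ne hml] at ha hb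
      have haw : a ≠ w := fun h => hw m' (h ▸ ha)
      have hbw : b ≠ w := fun h => hw m' (h ▸ hb)
      simpa [haw, hbw] using hf m' hm' a ha b hb

/-- Cutting an edge of length `s + t` at `w` preserves distances between old vertices. If one half
is the block left out, `w` hangs on the other half only, so its potential differs from that of the
old end by exactly the weight of that half. -/
theorem Spread.subdivide {k : ℕ} {B : ℕ → Finset ℕ} {W : ℕ → ℕ} (h : Spread k B W)
    {l l' u v w s t : ℕ} (hB : B l = {u, v}) (huv : u ≠ v) (hW : W l = s + t) (hl' : l' ≠ l)
    (hB' : B l' = ∅) (hw : ∀ m, w ∉ B m) :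
    Spread k (Function.update (Function.update B l {u, w}) l' {w, v})
      (Function.update (Function.update W l s) l' t) := by
  have hu : u ∈ B l := by simp [hB]
  have hv : v ∈ B l := by simp [hB]
  have huw : u ≠ w := fun h => hw l (h ▸ hu)
  have hvw : v ≠ w := fun h => hw l (h ▸ hv)
  have hne : ∀ m a, a ∈ B m → a ≠ w := fun m a ha h => hw m (h ▸ ha)
  obtain ⟨f₁, hf₁, hg₁⟩ := h l u hu v hv huv
  obtain ⟨f₂, hf₂, hg₂⟩ := h l v hv u hu huv.symm
  rw [hW] at hg₁ hg₂
  push_cast at hg₁ hg₂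
  intro m p hp q hq hpq
  by_cases hm' : m = l'
  · subst hm'
    simp only [Function.update_self, Finset.mem_insert, Finset.mem_singleton] at hp hq
    have key : ∀ (f : ℕ → ℤ) (z : ℤ), (∀ m, m ≠ l → ∀ a ∈ B m, ∀ b ∈ B m, f a ≤ f b + W m) →
        z ≤ f u + s → f u ≤ z + s →
        ∀ m', m' ≠ m → ∀ a ∈ Function.update (Function.update B l {u, w}) m {w, v} m',
        ∀ b ∈ Function.update (Function.update B l {u, w}) m {w, v} m',
        Function.update f w z a ≤ Function.update f w z b +
          (Function.update (Function.update W l s) m t m' : ℕ) := by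
      intro f z hf h1 h2 m' hm' a ha b hb
      rw [Function.update_of_ne hm'] at ha hb ⊢
      by_cases hml : m' = l
      · subst hml
        simp only [Function.update_self, Finset.mem_insert, Finset.mem_singleton] at ha hb ⊢
        rcases ha with rfl | rfl <;> rcases hb with rfl | rfl <;> simp [huw] <;> linarith
      · rw [Function.update_of_ne hml] at ha hb ⊢
        simpa [hne _ _ ha, hne _ _ hb] using hf m' hml a ha b hb
    have : (p = w ∧ q = v) ∨ (p = v ∧ q = w) := by grind
    rcases this with ⟨rfl, rfl⟩ | ⟨rfl, rfl⟩
    · refine ⟨_, key f₁ (f₁ u + s) hf₁ (by linarith) (by linarith), ?_⟩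
      simp [hvw]; linarith
    · refine ⟨_, key f₂ (f₂ u - s) hf₂ (by linarith) (by linarith), ?_⟩
      simp [hvw]; linarith
  by_cases hm : m = l
  · subst hm
    simp only [Function.update_of_ne hm', Function.update_self, Finset.mem_insert,
      Finset.mem_singleton] at hp hq
    have key : ∀ (f : ℕ → ℤ) (z : ℤ), (∀ m', m' ≠ m → ∀ a ∈ B m', ∀ b ∈ B m', f a ≤ f b + W m') →
        z ≤ f v + t → f v ≤ z + t →
        ∀ m', m' ≠ m → ∀ a ∈ Function.update (Function.update B m {u, w}) l' {w, v} m',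
        ∀ b ∈ Function.update (Function.update B m {u, w}) l' {w, v} m',
        Function.update f w z a ≤ Function.update f w z b +
          (Function.update (Function.update W m s) l' t m' : ℕ) := by
      intro f z hf h1 h2 m' hmm a ha b hb
      by_cases hml : m' = l'
      · subst hml
        simp only [Function.update_self, Finset.mem_insert, Finset.mem_singleton] at ha hb ⊢
        rcases ha with rfl | rfl <;> rcases hb with rfl | rfl <;> simp [hvw] <;> linarith
      · rw [Function.update_of_ne hml, Function.update_of_ne hmm] at ha hb ⊢
        simpa [hne _ _ ha, hne _ _ hb] using hf m' hmm a ha b hb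
    have : (p = u ∧ q = w) ∨ (p = w ∧ q = u) := by grind
    rcases this with ⟨rfl, rfl⟩ | ⟨rfl, rfl⟩
    · refine ⟨_, key f₁ (f₁ v - t) hf₁ (by linarith) (by linarith), ?_⟩
      simp [huw, hm']; linarith
    · refine ⟨_, key f₂ (f₂ v + t) hf₂ (by linarith) (by linarith), ?_⟩
      simp [huw, hm']; linarith
  simp only [Function.update_of_ne hm', Function.update_of_ne hm] at hp hq ⊢
  obtain ⟨f, hf, hg⟩ := h m p hp q hq hpq
  have h1 := hf l (Ne.symm hm) u hu v hv
  have h2 := hf l (Ne.symm hm) v hv u hu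
  rw [hW] at h1 h2
  push_cast at h1 h2
  -- The least value at `w` that respects both lower bounds; the upper bounds hold because `f u` and
  -- `f v` differ by at most `s + t`.
  refine ⟨Function.update f w (max (f u - s) (f v - t)), fun m' hmm a ha b hb => ?_,
    by simpa [hne _ _ hp, hne _ _ hq] using hg⟩
  by_cases hml' : m' = l'
  · subst hml'
    simp only [Function.update_self, Finset.mem_insert, Finset.mem_singleton] at ha hb ⊢
    rcases ha with rfl | rfl <;> rcases hb with rfl | rfl <;> simp [hvw] <;> grind
  rw [Function.update_of_ne hml'] at ha hb ⊢
  by_cases hml : m' = l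
  · subst hml
    simp only [Function.update_self, Finset.mem_insert, Finset.mem_singleton] at ha hb ⊢
    rcases ha with rfl | rfl <;> rcases hb with rfl | rfl <;> simp [huw] <;> grind
  · rw [Function.update_of_ne hml] at ha hb ⊢
    simpa [hne _ _ ha, hne _ _ hb] using hf m' hmm a ha b hb

/-- A cycle of length `k` cannot run through the blocks of a `k`-spread family of blocks of weight
one with fewer than `k` vertices each. -/
theorem Spread.not_cycle {k : ℕ} {B : ℕ → Finset ℕ} {W : ℕ → ℕ} (h : Spread k B W)
    (hW : ∀ l, W l ≤ 1) (hB : ∀ l, (B l).card < k) (c : ℕ → ℕ)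
    (hinj : Set.InjOn c (Set.Iio k)) (hper : c k = c 0)
    (hc : ∀ i < k, ∃ l, c i ∈ B l ∧ c (i + 1) ∈ B l) : False := by
  classical
  have hk : 0 < k := (Nat.zero_le _).trans_lt (hB 0)
  choose! e he he' using hc
  have hex : ∃ j, j < k ∧ e j ≠ e 0 := by
    by_contra! hall
    have : (Finset.range k).image c ⊆ B (e 0) := by
      intro z hz
      obtain ⟨i, hi, rfl⟩ := Finset.mem_image.1 hz
      have hi := Finset.mem_range.1 hi
      exact hall i hi ▸ he i hi
    have hcard := Finset.card_le_card this
    rw [Finset.card_image_of_injOn (by simpa [Set.InjOn] using hinj), Finset.card_range] at hcard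
    exact absurd (hB (e 0)) (by omega)
  -- `j` is the first edge that leaves the block of edge `0`, so `j ≥ 1`.
  obtain ⟨hjk, hj⟩ := Nat.find_spec hex
  have hmin := fun i => Nat.find_min (H := hex) (m := i)
  set j := Nat.find hex
  have hj0 : j ≠ 0 := fun h0 => hj (by rw [h0])
  have hcj : c j ∈ B (e 0) := by
    have h1 := hmin (j - 1) (by omega)
    have h2 : e (j - 1) = e 0 := by by_contra h3; exact h1 ⟨by omega, h3⟩
    have h3 := he' (j - 1) (by omega)
    rwa [h2, Nat.sub_add_cancel (by omega)] at h3
  -- `i` is the first return to that block, or `k`, where the cycle closes up in it. From `c j` to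
  -- `c i` the cycle stays outside the block for `i - j ≤ k - 1` steps, while the two vertices are
  -- at distance at least `k` there.
  have hex' : ∃ i, j < i ∧ (i = k ∨ e i = e 0) := ⟨k, hjk, Or.inl rfl⟩
  obtain ⟨hji, hi⟩ := Nat.find_spec hex'
  have hmin' := fun i => Nat.find_min (H := hex') (m := i)
  have hik : Nat.find hex' ≤ k := Nat.find_min' hex' ⟨hjk, Or.inl rfl⟩
  set i := Nat.find hex'
  have hci : c i ∈ B (e 0) := by
    rcases hi with hi | hi
    · rw [hi, hper]; exact he 0 hk
    · rcases hik.eq_or_lt with h1 | h1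
      · rw [h1, hper]; exact he 0 hk
      · exact hi ▸ he i h1
  have hne : c j ≠ c i := by
    rcases hik.eq_or_lt with h1 | h1
    · rw [h1, hper]
      exact fun h2 => hj0 (hinj hjk hk h2)
    · exact fun h2 => hji.ne (hinj hjk h1 h2)
  obtain ⟨f, hf, hg⟩ := h (e 0) _ hcj _ hci hne
  have hstep : ∀ d, j + d ≤ i → f (c j) ≤ f (c (j + d)) + d := by
    intro d
    induction d with
    | zero => simp
    | succ d ih =>
      intro hd
      have h1 := ih (by omega)
      have hne' : e (j + d) ≠ e 0 := by
        rcases Nat.eq_zero_or_pos d with rfl | hd0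
        · exact hj
        · intro h2
          exact hmin' (j + d) (by omega) ⟨by omega, Or.inr h2⟩
      have h2 := hf _ hne' _ (he (j + d) (by omega)) _ (he' (j + d) (by omega))
      have h3 := hW (e (j + d))
      push_cast
      rw [add_assoc] at h2
      have h4 : (W (e (j + d)) : ℤ) ≤ 1 := by exact_mod_cast h3
      linarith
  have h1 := hstep (i - j) (by omega)
  rw [Nat.add_sub_cancel' hji.le] at h1
  have h2 := hW (e 0)
  omega

end PlanarAntiRamsey

/-! ### Triangulations as sets of oriented triangles, and the two moves -/

namespace PlanarAntiRamsey

open Relation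

/-- The three cyclic shifts of an oriented triangle. -/
def rotations (a b c : ℕ) : Finset (ℕ × ℕ × ℕ) := {(a, b, c), (b, c, a), (c, a, b)}

theorem mem_rotations {a b c : ℕ} {t : ℕ × ℕ × ℕ} :
    t ∈ rotations a b c ↔ t = (a, b, c) ∨ t = (b, c, a) ∨ t = (c, a, b) := by
  simp [rotations]

theorem sum_rotations {a b c : ℕ} (hca : c ≠ a) (g : ℕ × ℕ × ℕ → ℕ) :
    ∑ t ∈ rotations a b c, g t = g (a, b, c) + g (b, c, a) + g (c, a, b) := by
  rw [rotations, Finset.sum_insert, Finset.sum_insert, Finset.sum_singleton, add_assoc] <;>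
    simp <;> omega

/-- The oriented triangles `T` on the vertices `0, …, n - 1` are the faces of a triangulation of
the sphere: every dart lies on exactly one triangle, the link of every vertex is a cycle, the
surface is connected, and the number of darts is the one prescribed by Euler's formula. -/
structure IsTriangulation (n : ℕ) (T : Finset (ℕ × ℕ × ℕ)) : Prop where
  lt : ∀ {a b c}, (a, b, c) ∈ T → a < n
  ne : ∀ {a b c}, (a, b, c) ∈ T → a ≠ b
  cyc : ∀ {a b c}, (a, b, c) ∈ T → (b, c, a) ∈ T
  unique : ∀ {a b c d}, (a, b, c) ∈ T → (a, b, d) ∈ T → c = d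
  symm : ∀ {a b c}, (a, b, c) ∈ T → ∃ d, (b, a, d) ∈ T
  link : ∀ {v a b c d}, (v, a, c) ∈ T → (v, b, d) ∈ T →
    ReflTransGen (fun x y => (v, x, y) ∈ T) a b
  conn : ∀ {a b}, a < n → b < n → ReflTransGen (fun x y => ∃ c, (x, y, c) ∈ T) a b
  card : T.card + 12 = 6 * n

/-- The link of a vertex stays connected if its steps lift along a map `φ` and every new neighbor
is joined to the image of `φ` in both directions. -/
theorem reflTransGen_of_lift {R R' : ℕ → ℕ → Prop} {D : ℕ → Prop} (φ : ℕ → ℕ)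
    (hD : ∀ a b, D a → D b → ReflTransGen R a b)
    (hR : ∀ a b, R a b → ReflTransGen R' (φ a) (φ b)) {a b : ℕ}
    (ha : ∃ s, D s ∧ ReflTransGen R' a (φ s)) (hb : ∃ s, D s ∧ ReflTransGen R' (φ s) b) :
    ReflTransGen R' a b := by
  obtain ⟨s, hs, has⟩ := ha
  obtain ⟨t, ht, htb⟩ := hb
  exact (has.trans (ReflTransGen.lift' φ hR _ _ (hD s t hs ht))).trans htb

/-- Insert the vertex `w` into the triangle `(u, v, x)`. -/
def stack (T : Finset (ℕ × ℕ × ℕ)) (u v x w : ℕ) : Finset (ℕ × ℕ × ℕ) :=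
  (T \ rotations u v x) ∪ (rotations u v w ∪ (rotations v x w ∪ rotations x u w))

/-- Insert the vertex `w` on the edge `uv` that lies on the triangles `(u, v, x)` and
`(v, u, y)`. -/
def subdivide (T : Finset (ℕ × ℕ × ℕ)) (u v x y w : ℕ) : Finset (ℕ × ℕ × ℕ) :=
  (T \ (rotations u v x ∪ rotations v u y)) ∪
    ((rotations u w x ∪ rotations w v x) ∪ (rotations v w y ∪ rotations w u y))

theorem mem_stack {T : Finset (ℕ × ℕ × ℕ)} {u v x w : ℕ} {t : ℕ × ℕ × ℕ} :
    t ∈ stack T u v x w ↔ (t ∈ T ∧ ¬ (t = (u, v, x) ∨ t = (v, x, u) ∨ t = (x, u, v))) ∨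
      ((t = (u, v, w) ∨ t = (v, w, u) ∨ t = (w, u, v)) ∨
      ((t = (v, x, w) ∨ t = (x, w, v) ∨ t = (w, v, x)) ∨
      (t = (x, u, w) ∨ t = (u, w, x) ∨ t = (w, x, u)))) := by
  simp only [stack, Finset.mem_union, Finset.mem_sdiff, mem_rotations]

theorem mem_subdivide {T : Finset (ℕ × ℕ × ℕ)} {u v x y w : ℕ} {t : ℕ × ℕ × ℕ} :
    t ∈ subdivide T u v x y w ↔
      (t ∈ T ∧ ¬ ((t = (u, v, x) ∨ t = (v, x, u) ∨ t = (x, u, v)) ∨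
        (t = (v, u, y) ∨ t = (u, y, v) ∨ t = (y, v, u)))) ∨
      (((t = (u, w, x) ∨ t = (w, x, u) ∨ t = (x, u, w)) ∨
        (t = (w, v, x) ∨ t = (v, x, w) ∨ t = (x, w, v))) ∨
      ((t = (v, w, y) ∨ t = (w, y, v) ∨ t = (y, v, w)) ∨
        (t = (w, u, y) ∨ t = (u, y, w) ∨ t = (y, w, u)))) := by
  simp only [subdivide, Finset.mem_union, Finset.mem_sdiff, mem_rotations]

namespace IsTriangulation

variable {n : ℕ} {T : Finset (ℕ × ℕ × ℕ)}

theorem rotations_subset (h : IsTriangulation n T) {u v x : ℕ} (hx : (u, v, x) ∈ T) :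
    rotations u v x ⊆ T := by
  intro t ht
  rcases mem_rotations.1 ht with rfl | rfl | rfl
  exacts [hx, h.cyc hx, h.cyc (h.cyc hx)]

/-- A triple of `T` is determined by its first two entries, so for `g` blind to the third entry this
is a sum over darts; the `0` is a placeholder. The darts of the removed triangle reappear, and only
the darts at `n` are new. The case `g = 1` yields Euler's count, `g = edgeWeight P` the count of
pole-free edges. -/
theorem sum_stack (h : IsTriangulation n T) {u v x : ℕ} (hx : (u, v, x) ∈ T)
    (g : ℕ × ℕ × ℕ → ℕ) (hg : ∀ a b c d, g (a, b, c) = g (a, b, d)) :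
    ∑ t ∈ stack T u v x n, g t = ∑ t ∈ T, g t + (g (u, n, 0) + g (n, u, 0)) +
      (g (v, n, 0) + g (n, v, 0)) + (g (x, n, 0) + g (n, x, 0)) := by
  have huv := h.ne hx
  have hvx := h.ne (h.cyc hx)
  have hxu := h.ne (h.cyc (h.cyc hx))
  have hu := h.lt hx
  have hv := h.lt (h.cyc hx)
  have hxn := h.lt (h.cyc (h.cyc hx))
  have hT := Finset.sum_sdiff (f := g) (h.rotations_subset hx)
  rw [sum_rotations hxu] at hT
  rw [stack, Finset.sum_union, Finset.sum_union, Finset.sum_union,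
    sum_rotations hu.ne', sum_rotations hv.ne',
    sum_rotations hxn.ne', ← hT, hg u v n x, hg v n u 0, hg n u v 0, hg v x n u,
    hg x n v 0, hg n v x 0, hg x u n v, hg u n x 0, hg n x u 0]
  · ring
  · rw [Finset.disjoint_left]
    simp only [mem_rotations]
    rintro ⟨a, b, c⟩ h1 h2
    simp only [Prod.mk.injEq] at h1 h2
    omega
  · rw [Finset.disjoint_left]
    simp only [mem_rotations, Finset.mem_union]
    rintro ⟨a, b, c⟩ h1 h2
    simp only [Prod.mk.injEq] at h1 h2
    omega
  · rw [Finset.disjoint_left]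
    simp only [mem_rotations, Finset.mem_union, Finset.mem_sdiff]
    rintro ⟨a, b, c⟩ ⟨h1, -⟩ h2
    have ha := h.lt h1
    have hb := h.lt (h.cyc h1)
    have hc := h.lt (h.cyc (h.cyc h1))
    simp only [Prod.mk.injEq] at h2
    omega

/-- Here the two darts of `uv` are lost; they stand on the left to avoid subtraction in `ℕ`. -/
theorem sum_subdivide (h : IsTriangulation n T) {u v x y : ℕ} (hx : (u, v, x) ∈ T)
    (hy : (v, u, y) ∈ T) (g : ℕ × ℕ × ℕ → ℕ)
    (hg : ∀ a b c d, g (a, b, c) = g (a, b, d)) :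
    ∑ t ∈ subdivide T u v x y n, g t + (g (u, v, 0) + g (v, u, 0)) =
      ∑ t ∈ T, g t + (g (u, n, 0) + g (n, u, 0)) + (g (v, n, 0) + g (n, v, 0)) +
        (g (x, n, 0) + g (n, x, 0)) + (g (y, n, 0) + g (n, y, 0)) := by
  have huv := h.ne hx
  have hvx := h.ne (h.cyc hx)
  have hxu := h.ne (h.cyc (h.cyc hx))
  have huy := h.ne (h.cyc hy)
  have hyv := h.ne (h.cyc (h.cyc hy))
  have hu := h.lt hx
  have hv := h.lt (h.cyc hx)
  have hxn := h.lt (h.cyc (h.cyc hx))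
  have hyn := h.lt (h.cyc (h.cyc hy))
  have hT := Finset.sum_sdiff (f := g)
    (Finset.union_subset (h.rotations_subset hx) (h.rotations_subset hy))
  rw [Finset.sum_union, sum_rotations hxu, sum_rotations hyv] at hT
  · rw [subdivide, Finset.sum_union, Finset.sum_union, Finset.sum_union, Finset.sum_union,
      sum_rotations hxu, sum_rotations hxn.ne,
      sum_rotations hyv, sum_rotations hyn.ne, ← hT,
      hg u n x 0, hg n x u 0, hg x u n v, hg n v x 0, hg v x n u, hg x n v 0,
      hg v n y 0, hg n y v 0, hg y v n u, hg n u y 0, hg u y n v, hg y n u 0,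
      hg u v x 0, hg v u y 0]
    · ring
    all_goals
      rw [Finset.disjoint_left]
      simp only [mem_rotations, Finset.mem_union, Finset.mem_sdiff]
    iterate 3
      rintro ⟨a, b, c⟩ h1 h2
      simp only [Prod.mk.injEq] at h1 h2
      omega
    rintro ⟨a, b, c⟩ ⟨h1, -⟩ h2
    have ha := h.lt h1
    have hb := h.lt (h.cyc h1)
    have hc := h.lt (h.cyc (h.cyc h1))
    simp only [Prod.mk.injEq] at h2
    omega
  · rw [Finset.disjoint_left]
    simp only [mem_rotations]
    rintro ⟨a, b, c⟩ h1 h2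
    simp only [Prod.mk.injEq] at h1 h2
    omega

end IsTriangulation

end PlanarAntiRamsey

/-! ### The two moves preserve triangulations -/

namespace PlanarAntiRamsey

open Relation

namespace IsTriangulation

variable {n : ℕ} {T : Finset (ℕ × ℕ × ℕ)}

theorem cyc_mem_rotations {a b c u v x : ℕ} :
    (b, c, a) ∈ rotations u v x ↔ (a, b, c) ∈ rotations u v x := by
  simp only [mem_rotations, Prod.mk.injEq]
  constructor
  all_goals
    rintro (⟨rfl, rfl, rfl⟩ | ⟨rfl, rfl, rfl⟩ | ⟨rfl, rfl, rfl⟩) <;> simp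

theorem lt₂ (h : IsTriangulation n T) {a b c : ℕ} (ht : (a, b, c) ∈ T) : b < n :=
  h.lt (h.cyc ht)

theorem lt₃ (h : IsTriangulation n T) {a b c : ℕ} (ht : (a, b, c) ∈ T) : c < n :=
  h.lt (h.cyc (h.cyc ht))

theorem adj_stack {u v x a b c : ℕ} (ht : (a, b, c) ∈ T) :
    ∃ d, (a, b, d) ∈ stack T u v x n := by
  by_cases hr : (a, b, c) ∈ rotations u v x
  · rw [mem_rotations] at hr
    simp only [Prod.mk.injEq] at hr
    refine ⟨n, mem_stack.2 (Or.inr ?_)⟩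
    rcases hr with ⟨rfl, rfl, rfl⟩ | ⟨rfl, rfl, rfl⟩ | ⟨rfl, rfl, rfl⟩ <;> simp
  · exact ⟨c, mem_stack.2 (Or.inl ⟨ht, by rwa [← mem_rotations]⟩)⟩

-- Only the links at the corners of the removed triangle change: there a link step across the
-- triangle becomes two steps through `n`. Every old dart survives.
set_option maxHeartbeats 2000000 in
theorem stack (h : IsTriangulation n T) {u v x : ℕ} (hx : (u, v, x) ∈ T) :
    IsTriangulation (n + 1) (stack T u v x n) := by
  have huv := h.ne hx
  have hvx := h.ne (h.cyc hx)
  have hxu := h.ne (h.cyc (h.cyc hx))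
  have hu := h.lt hx
  have hv := h.lt₂ hx
  have hxn := h.lt₃ hx
  have hx1 := h.cyc hx
  have hx2 := h.cyc hx1
  refine ⟨?_, ?_, ?_, ?_, ?_, ?_, ?_, ?_⟩
  · intro a b c ht
    rcases mem_stack.1 ht with ⟨h1, -⟩ | h1
    · exact (h.lt h1).trans n.lt_succ_self
    · simp only [Prod.mk.injEq] at h1
      omega
  · intro a b c ht
    rcases mem_stack.1 ht with ⟨h1, -⟩ | h1
    · exact h.ne h1
    · simp only [Prod.mk.injEq] at h1
      omega
  · intro a b c ht
    simp only [PlanarAntiRamsey.stack, Finset.mem_union, Finset.mem_sdiff,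
      cyc_mem_rotations (a := a)] at ht ⊢
    exact ht.imp_left fun h1 => ⟨h.cyc h1.1, h1.2⟩
  · intro a b c d h1 h2
    rw [mem_stack] at h1 h2
    have cross : ∀ {c d}, (a, b, c) ∈ T → ¬ ((a, b, c) = (u, v, x) ∨ (a, b, c) = (v, x, u) ∨
        (a, b, c) = (x, u, v)) →
      (((a, b, d) = (u, v, n) ∨ (a, b, d) = (v, n, u) ∨ (a, b, d) = (n, u, v)) ∨
      (((a, b, d) = (v, x, n) ∨ (a, b, d) = (x, n, v) ∨ (a, b, d) = (n, v, x)) ∨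
      ((a, b, d) = (x, u, n) ∨ (a, b, d) = (u, n, x) ∨ (a, b, d) = (n, x, u)))) → False := by
      intro c d h1 h1' h2
      have ha : a ≠ n := (h.lt h1).ne
      have hb : b ≠ n := (h.lt₂ h1).ne
      have hne : ∀ d, (a, b, d) ∈ T → c = d := fun d hd => h.unique h1 hd
      have e1 : a = u → b ≠ v := by rintro rfl rfl; simp [hne _ hx] at h1'
      have e2 : a = v → b ≠ x := by rintro rfl rfl; simp [hne _ hx1] at h1'
      have e3 : a = x → b ≠ u := by rintro rfl rfl; simp [hne _ hx2] at h1'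
      simp only [Prod.mk.injEq] at h2
      rcases h2 with (⟨h3, h4, -⟩ | ⟨h3, h4, -⟩ | ⟨h3, h4, -⟩) |
        (⟨h3, h4, -⟩ | ⟨h3, h4, -⟩ | ⟨h3, h4, -⟩) | (⟨h3, h4, -⟩ | ⟨h3, h4, -⟩ | ⟨h3, h4, -⟩)
      exacts [e1 h3 h4, hb h4, ha h3, e2 h3 h4, hb h4, ha h3, e3 h3 h4, hb h4, ha h3]
    rcases h1 with ⟨h1, h1'⟩ | h1 <;> rcases h2 with ⟨h2, h2'⟩ | h2
    · exact h.unique h1 h2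
    · exact (cross h1 h1' h2).elim
    · exact (cross h2 h2' h1).elim
    · simp only [Prod.mk.injEq] at h1 h2
      rcases h1 with (⟨rfl, rfl, rfl⟩ | ⟨rfl, rfl, rfl⟩ | ⟨rfl, rfl, rfl⟩) |
        (⟨rfl, rfl, rfl⟩ | ⟨rfl, rfl, rfl⟩ | ⟨rfl, rfl, rfl⟩) |
        (⟨rfl, rfl, rfl⟩ | ⟨rfl, rfl, rfl⟩ | ⟨rfl, rfl, rfl⟩) <;> omega
  · intro a b c ht
    have old : ∀ {a b c}, (a, b, c) ∈ T → ∃ d, (b, a, d) ∈ PlanarAntiRamsey.stack T u v x n := by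
      intro a b c ht
      obtain ⟨d, hd⟩ := h.symm ht
      exact adj_stack hd
    rw [mem_stack] at ht
    rcases ht with ⟨h1, -⟩ | h1
    · exact old h1
    · simp only [Prod.mk.injEq] at h1
      rcases h1 with (⟨rfl, rfl, rfl⟩ | ⟨rfl, rfl, rfl⟩ | ⟨rfl, rfl, rfl⟩) |
        (⟨rfl, rfl, rfl⟩ | ⟨rfl, rfl, rfl⟩ | ⟨rfl, rfl, rfl⟩) |
        (⟨rfl, rfl, rfl⟩ | ⟨rfl, rfl, rfl⟩ | ⟨rfl, rfl, rfl⟩)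
      · exact old hx
      · exact ⟨x, by simp [mem_stack]⟩
      · exact ⟨x, by simp [mem_stack]⟩
      · exact old hx1
      · exact ⟨u, by simp [mem_stack]⟩
      · exact ⟨u, by simp [mem_stack]⟩
      · exact old hx2
      · exact ⟨v, by simp [mem_stack]⟩
      · exact ⟨v, by simp [mem_stack]⟩
  · intro z a b c d ha hb
    by_cases hz : z = n
    · subst hz
      have s1 : (z, u, v) ∈ PlanarAntiRamsey.stack T u v x z := by simp [mem_stack]
      have s2 : (z, v, x) ∈ PlanarAntiRamsey.stack T u v x z := by simp [mem_stack]
      have s3 : (z, x, u) ∈ PlanarAntiRamsey.stack T u v x z := by simp [mem_stack]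
      have nb : ∀ {a c}, (z, a, c) ∈ PlanarAntiRamsey.stack T u v x z →
          a = u ∨ a = v ∨ a = x := by
        intro a c ha
        rcases mem_stack.1 ha with ⟨h1, -⟩ | h1
        · exact absurd (h.lt h1) (lt_irrefl _)
        · simp only [Prod.mk.injEq] at h1
          omega
      have g1 := ReflTransGen.single (r := fun x_1 y => (z, x_1, y) ∈
        PlanarAntiRamsey.stack T u v x z) s1
      have g2 := ReflTransGen.single (r := fun x_1 y => (z, x_1, y) ∈
        PlanarAntiRamsey.stack T u v x z) s2
      have g3 := ReflTransGen.single (r := fun x_1 y => (z, x_1, y) ∈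
        PlanarAntiRamsey.stack T u v x z) s3
      rcases nb ha with rfl | rfl | rfl <;> rcases nb hb with rfl | rfl | rfl
      exacts [.refl, g1, g1.trans g2, g2.trans g3, .refl, g2, g3, g3.trans g1, .refl]
    · refine reflTransGen_of_lift (R := fun x y => (z, x, y) ∈ T) (D := fun a => ∃ c, (z, a, c) ∈ T)
        id ?_ ?_ ?_ ?_
      · rintro a b ⟨c, hc⟩ ⟨d, hd⟩
        exact h.link hc hd
      · intro a b hab
        by_cases hr : (z, a, b) ∈ rotations u v x
        · rw [mem_rotations] at hr
          simp only [Prod.mk.injEq] at hr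
          refine (ReflTransGen.single (b := n) ?_).tail ?_
          all_goals
            refine mem_stack.2 (Or.inr ?_)
            rcases hr with ⟨rfl, rfl, rfl⟩ | ⟨rfl, rfl, rfl⟩ | ⟨rfl, rfl, rfl⟩ <;> simp
        · exact ReflTransGen.single (mem_stack.2 (Or.inl ⟨hab, by rwa [← mem_rotations]⟩))
      · by_cases han : a = n
        · subst han
          have : (z = u) ∨ (z = v) ∨ (z = x) := by
            rcases mem_stack.1 ha with ⟨h1, -⟩ | h1
            · exact absurd (h.lt₂ h1) (lt_irrefl _)
            · simp only [Prod.mk.injEq] at h1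
              omega
          rcases this with rfl | rfl | rfl
          · exact ⟨x, h.symm hx2 , .single (mem_stack.2 (by simp))⟩
          · exact ⟨u, h.symm hx , .single (mem_stack.2 (by simp))⟩
          · exact ⟨v, h.symm hx1 , .single (mem_stack.2 (by simp))⟩
        · refine ⟨a, ?_, .refl⟩
          rcases mem_stack.1 ha with ⟨h1, -⟩ | h1
          · exact ⟨c, h1⟩
          · simp only [Prod.mk.injEq] at h1
            have : (z = u ∧ a = v) ∨ (z = v ∧ a = x) ∨ (z = x ∧ a = u) := by omega
            rcases this with ⟨rfl, rfl⟩ | ⟨rfl, rfl⟩ | ⟨rfl, rfl⟩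
            exacts [⟨_, hx⟩, ⟨_, hx1⟩, ⟨_, hx2⟩]
      · by_cases han : b = n
        · subst han
          have : (z = u) ∨ (z = v) ∨ (z = x) := by
            rcases mem_stack.1 hb with ⟨h1, -⟩ | h1
            · exact absurd (h.lt₂ h1) (lt_irrefl _)
            · simp only [Prod.mk.injEq] at h1
              omega
          rcases this with rfl | rfl | rfl
          · exact ⟨v, ⟨_, hx⟩, .single (mem_stack.2 (by simp))⟩
          · exact ⟨x, ⟨_, hx1⟩, .single (mem_stack.2 (by simp))⟩
          · exact ⟨u, ⟨_, hx2⟩, .single (mem_stack.2 (by simp))⟩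
        · refine ⟨b, ?_, .refl⟩
          rcases mem_stack.1 hb with ⟨h1, -⟩ | h1
          · exact ⟨d, h1⟩
          · simp only [Prod.mk.injEq] at h1
            have : (z = u ∧ b = v) ∨ (z = v ∧ b = x) ∨ (z = x ∧ b = u) := by omega
            rcases this with ⟨rfl, rfl⟩ | ⟨rfl, rfl⟩ | ⟨rfl, rfl⟩
            exacts [⟨_, hx⟩, ⟨_, hx1⟩, ⟨_, hx2⟩]
  · intro a b ha hb
    have old : ∀ {a b}, a < n → b < n → ReflTransGen (fun x_1 y => ∃ c, (x_1, y, c) ∈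
        PlanarAntiRamsey.stack T u v x n) a b := by
      intro a b ha hb
      exact ReflTransGen.mono (fun _ _ ⟨_, hc⟩ => adj_stack hc) _ _ (h.conn ha hb)
    have e1 : ∃ c, (u, n, c) ∈ PlanarAntiRamsey.stack T u v x n := ⟨x, mem_stack.2 (by simp)⟩
    have e2 : ∃ c, (n, u, c) ∈ PlanarAntiRamsey.stack T u v x n := ⟨v, mem_stack.2 (by simp)⟩
    rcases Nat.lt_succ_iff_lt_or_eq.1 ha with ha | rfl <;>
      rcases Nat.lt_succ_iff_lt_or_eq.1 hb with hb | rfl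
    · exact old ha hb
    · exact (old ha hu).tail e1
    · exact (old hu hb).head e2
    · exact .refl
  · have := h.sum_stack hx (fun _ => 1) (fun _ _ _ _ => rfl)
    have hc := h.card
    simp only [← Finset.card_eq_sum_ones] at this
    omega

-- If `x = y`, the dart from `n` to `x` would lie on two triangles; this is what `hxy` excludes. All
-- old darts survive except those of `uv`, which are replaced by paths through `n`.
set_option maxHeartbeats 4000000 in
theorem subdivide (h : IsTriangulation n T) {u v x y : ℕ} (hx : (u, v, x) ∈ T)
    (hy : (v, u, y) ∈ T) (hxy : x ≠ y) :
    IsTriangulation (n + 1) (subdivide T u v x y n) := by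
  have huv := h.ne hx
  have hvx := h.ne (h.cyc hx)
  have hxu := h.ne (h.cyc (h.cyc hx))
  have huy := h.ne (h.cyc hy)
  have hyv := h.ne (h.cyc (h.cyc hy))
  have hu := h.lt hx
  have hv := h.lt₂ hx
  have hxn := h.lt₃ hx
  have hyn := h.lt₃ hy
  have hx1 := h.cyc hx
  have hx2 := h.cyc hx1
  have hy1 := h.cyc hy
  have hy2 := h.cyc hy1
  have keep : ∀ {a b c}, (a, b, c) ∈ T → ¬ ((a = u ∧ b = v) ∨ (a = v ∧ b = u)) →
      ∃ d, (a, b, d) ∈ PlanarAntiRamsey.subdivide T u v x y n := by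
    intro a b c ht hab
    by_cases hr : (a, b, c) ∈ rotations u v x ∪ rotations v u y
    · refine ⟨n, mem_subdivide.2 (Or.inr ?_)⟩
      simp only [Finset.mem_union, mem_rotations, Prod.mk.injEq] at hr
      rcases hr with (⟨rfl, rfl, rfl⟩ | ⟨rfl, rfl, rfl⟩ | ⟨rfl, rfl, rfl⟩) |
        (⟨rfl, rfl, rfl⟩ | ⟨rfl, rfl, rfl⟩ | ⟨rfl, rfl, rfl⟩) <;> simp at hab ⊢
    · refine ⟨c, mem_subdivide.2 (Or.inl ⟨ht, ?_⟩)⟩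
      simpa only [Finset.mem_union, mem_rotations] using hr
  refine ⟨?_, ?_, ?_, ?_, ?_, ?_, ?_, ?_⟩
  · intro a b c ht
    rcases mem_subdivide.1 ht with ⟨h1, -⟩ | h1
    · exact (h.lt h1).trans n.lt_succ_self
    · simp only [Prod.mk.injEq] at h1
      omega
  · intro a b c ht
    rcases mem_subdivide.1 ht with ⟨h1, -⟩ | h1
    · exact h.ne h1
    · simp only [Prod.mk.injEq] at h1
      omega
  · intro a b c ht
    simp only [PlanarAntiRamsey.subdivide, Finset.mem_union, Finset.mem_sdiff,
      cyc_mem_rotations (a := a)] at ht ⊢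
    exact ht.imp_left fun h1 => ⟨h.cyc h1.1, h1.2⟩
  · intro a b c d h1 h2
    rw [mem_subdivide] at h1 h2
    have cross : ∀ {c d}, (a, b, c) ∈ T → ¬ (((a, b, c) = (u, v, x) ∨ (a, b, c) = (v, x, u) ∨
        (a, b, c) = (x, u, v)) ∨ ((a, b, c) = (v, u, y) ∨ (a, b, c) = (u, y, v) ∨
        (a, b, c) = (y, v, u))) →
      (((a, b, d) = (u, n, x) ∨ (a, b, d) = (n, x, u) ∨ (a, b, d) = (x, u, n)) ∨
        ((a, b, d) = (n, v, x) ∨ (a, b, d) = (v, x, n) ∨ (a, b, d) = (x, n, v))) ∨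
      (((a, b, d) = (v, n, y) ∨ (a, b, d) = (n, y, v) ∨ (a, b, d) = (y, v, n)) ∨
        ((a, b, d) = (n, u, y) ∨ (a, b, d) = (u, y, n) ∨ (a, b, d) = (y, n, u))) → False := by
      intro c d h1 h1' h2
      have ha : a ≠ n := (h.lt h1).ne
      have hb : b ≠ n := (h.lt₂ h1).ne
      have hne : ∀ d, (a, b, d) ∈ T → c = d := fun d hd => h.unique h1 hd
      have e2 : a = v → b ≠ x := by rintro rfl rfl; simp [hne _ hx1] at h1'
      have e3 : a = x → b ≠ u := by rintro rfl rfl; simp [hne _ hx2] at h1'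
      have e4 : a = u → b ≠ y := by rintro rfl rfl; simp [hne _ hy1] at h1'
      have e5 : a = y → b ≠ v := by rintro rfl rfl; simp [hne _ hy2] at h1'
      simp only [Prod.mk.injEq] at h2
      rcases h2 with ((⟨h3, h4, -⟩ | ⟨h3, h4, -⟩ | ⟨h3, h4, -⟩) |
        (⟨h3, h4, -⟩ | ⟨h3, h4, -⟩ | ⟨h3, h4, -⟩)) |
        ((⟨h3, h4, -⟩ | ⟨h3, h4, -⟩ | ⟨h3, h4, -⟩) |
        (⟨h3, h4, -⟩ | ⟨h3, h4, -⟩ | ⟨h3, h4, -⟩))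
      exacts [hb h4, ha h3, e3 h3 h4, ha h3, e2 h3 h4, hb h4, hb h4, ha h3, e5 h3 h4, ha h3,
        e4 h3 h4, hb h4]
    rcases h1 with ⟨h1, h1'⟩ | h1 <;> rcases h2 with ⟨h2, h2'⟩ | h2
    · exact h.unique h1 h2
    · exact (cross h1 h1' h2).elim
    · exact (cross h2 h2' h1).elim
    · simp only [Prod.mk.injEq] at h1 h2
      rcases h1 with ((⟨rfl, rfl, rfl⟩ | ⟨rfl, rfl, rfl⟩ | ⟨rfl, rfl, rfl⟩) |
        (⟨rfl, rfl, rfl⟩ | ⟨rfl, rfl, rfl⟩ | ⟨rfl, rfl, rfl⟩)) |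
        ((⟨rfl, rfl, rfl⟩ | ⟨rfl, rfl, rfl⟩ | ⟨rfl, rfl, rfl⟩) |
        (⟨rfl, rfl, rfl⟩ | ⟨rfl, rfl, rfl⟩ | ⟨rfl, rfl, rfl⟩)) <;> omega
  · intro a b c ht
    have old : ∀ {a b c}, (a, b, c) ∈ T → ¬ ((a = u ∧ b = v) ∨ (a = v ∧ b = u)) →
        ∃ d, (b, a, d) ∈ PlanarAntiRamsey.subdivide T u v x y n := by
      intro a b c ht hab
      obtain ⟨d, hd⟩ := h.symm ht
      exact keep hd (by omega)
    rw [mem_subdivide] at ht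
    rcases ht with ⟨h1, h2⟩ | h1
    · refine old h1 ?_
      rintro (⟨rfl, rfl⟩ | ⟨rfl, rfl⟩)
      · have := h.unique h1 hx; simp_all
      · have := h.unique h1 hy; simp_all
    · simp only [Prod.mk.injEq] at h1
      rcases h1 with ((⟨rfl, rfl, rfl⟩ | ⟨rfl, rfl, rfl⟩ | ⟨rfl, rfl, rfl⟩) |
        (⟨rfl, rfl, rfl⟩ | ⟨rfl, rfl, rfl⟩ | ⟨rfl, rfl, rfl⟩)) |
        ((⟨rfl, rfl, rfl⟩ | ⟨rfl, rfl, rfl⟩ | ⟨rfl, rfl, rfl⟩) |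
        (⟨rfl, rfl, rfl⟩ | ⟨rfl, rfl, rfl⟩ | ⟨rfl, rfl, rfl⟩))
      · exact ⟨y, by simp [mem_subdivide]⟩
      · exact ⟨v, by simp [mem_subdivide]⟩
      · exact old hx2 (by omega)
      · exact ⟨y, by simp [mem_subdivide]⟩
      · exact old hx1 (by omega)
      · exact ⟨u, by simp [mem_subdivide]⟩
      · exact ⟨x, by simp [mem_subdivide]⟩
      · exact ⟨u, by simp [mem_subdivide]⟩
      · exact old hy2 (by omega)
      · exact ⟨x, by simp [mem_subdivide]⟩
      · exact old hy1 (by omega)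
      · exact ⟨v, by simp [mem_subdivide]⟩
  · intro z a b c d ha hb
    have wstep : ∀ p q : ℕ, ((z, p, q) ∈ PlanarAntiRamsey.subdivide T u v x y n) →
      ReflTransGen (fun p q => (z, p, q) ∈ PlanarAntiRamsey.subdivide T u v x y n) p q :=
      fun p q hpq => .single hpq
    by_cases hz : z = n
    · subst hz
      have g1 := wstep x u (by simp [mem_subdivide])
      have g2 := wstep v x (by simp [mem_subdivide])
      have g3 := wstep y v (by simp [mem_subdivide])
      have g4 := wstep u y (by simp [mem_subdivide])
      have nb : ∀ {a c}, (z, a, c) ∈ PlanarAntiRamsey.subdivide T u v x y z →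
          a = u ∨ a = v ∨ a = x ∨ a = y := by
        intro a c ha
        rcases mem_subdivide.1 ha with ⟨h1, -⟩ | h1
        · exact absurd (h.lt h1) (lt_irrefl _)
        · simp only [Prod.mk.injEq] at h1
          omega
      have hto : ∀ {a c}, (z, a, c) ∈ PlanarAntiRamsey.subdivide T u v x y z →
          ReflTransGen (fun p q => (z, p, q) ∈ PlanarAntiRamsey.subdivide T u v x y z) a u := by
        intro a c ha
        rcases nb ha with rfl | rfl | rfl | rfl
        exacts [.refl, g2.trans g1, g1, (g3.trans g2).trans g1]
      have hfrom : ∀ {a c}, (z, a, c) ∈ PlanarAntiRamsey.subdivide T u v x y z →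
          ReflTransGen (fun p q => (z, p, q) ∈ PlanarAntiRamsey.subdivide T u v x y z) u a := by
        intro a c ha
        rcases nb ha with rfl | rfl | rfl | rfl
        exacts [.refl, g4.trans g3, (g4.trans g3).trans g2, g4]
      exact (hto ha).trans (hfrom hb)
    -- In the link of `u` the new vertex takes the place of `v`, and in the link of `v` that of `u`.
    · let φ : ℕ → ℕ := fun p => if (z = u ∧ p = v) ∨ (z = v ∧ p = u) then n else p
      have hφ : ∀ p, ((z = u ∧ p = v) ∨ (z = v ∧ p = u)) ∧ φ p = n ∨
          ¬ ((z = u ∧ p = v) ∨ (z = v ∧ p = u)) ∧ φ p = p := by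
        intro p
        by_cases hp : (z = u ∧ p = v) ∨ (z = v ∧ p = u)
        · exact Or.inl ⟨hp, if_pos hp⟩
        · exact Or.inr ⟨hp, if_neg hp⟩
      have nb : ∀ {a c}, (z, a, c) ∈ PlanarAntiRamsey.subdivide T u v x y n →
          ∃ s, (∃ c, (z, s, c) ∈ T) ∧
          ReflTransGen (fun p q => (z, p, q) ∈ PlanarAntiRamsey.subdivide T u v x y n) a (φ s) ∧
          ∃ s, (∃ c, (z, s, c) ∈ T) ∧
          ReflTransGen (fun p q => (z, p, q) ∈ PlanarAntiRamsey.subdivide T u v x y n) (φ s) a := by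
        intro a c ha
        by_cases han : a = n
        · subst han
          have : z = u ∨ z = v ∨ z = x ∨ z = y := by
            rcases mem_subdivide.1 ha with ⟨h1, -⟩ | h1
            · exact absurd (h.lt₂ h1) (lt_irrefl _)
            · simp only [Prod.mk.injEq] at h1
              omega
          rcases this with rfl | rfl | rfl | rfl
          · have e : φ v = a := by simp [φ]
            exact ⟨v, ⟨_, hx⟩, e ▸ .refl, v, ⟨_, hx⟩, e ▸ .refl⟩
          · have e : φ u = a := by simp [φ]
            exact ⟨u, ⟨_, hy⟩, e ▸ .refl, u, ⟨_, hy⟩, e ▸ .refl⟩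
          · have e : φ v = v := by rcases hφ v with h | h <;> omega
            have e' : φ u = u := by rcases hφ u with h | h <;> omega
            refine ⟨v, h.symm hx1, ?_, u, ⟨_, hx2⟩, ?_⟩
            · rw [e]; exact wstep _ _ (by simp [mem_subdivide])
            · rw [e']; exact wstep _ _ (by simp [mem_subdivide])
          · have e : φ v = v := by rcases hφ v with h | h <;> omega
            have e' : φ u = u := by rcases hφ u with h | h <;> omega
            refine ⟨u, h.symm hy1, ?_, v, ⟨_, hy2⟩, ?_⟩
            · rw [e']; exact wstep _ _ (by simp [mem_subdivide])
            · rw [e]; exact wstep _ _ (by simp [mem_subdivide])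
        · have hD : (∃ c, (z, a, c) ∈ T) ∧ ¬ ((z = u ∧ a = v) ∨ (z = v ∧ a = u)) := by
            rcases mem_subdivide.1 ha with ⟨h1, h2⟩ | h1
            · refine ⟨⟨c, h1⟩, ?_⟩
              rintro (⟨rfl, rfl⟩ | ⟨rfl, rfl⟩)
              · have := h.unique h1 hx; simp_all
              · have := h.unique h1 hy; simp_all
            · simp only [Prod.mk.injEq] at h1
              have : (z = v ∧ a = x) ∨ (z = x ∧ a = u) ∨ (z = u ∧ a = y) ∨ (z = y ∧ a = v) := by
                omega
              refine ⟨?_, by omega⟩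
              rcases this with ⟨rfl, rfl⟩ | ⟨rfl, rfl⟩ | ⟨rfl, rfl⟩ | ⟨rfl, rfl⟩
              exacts [⟨_, hx1⟩, ⟨_, hx2⟩, ⟨_, hy1⟩, ⟨_, hy2⟩]
          have e : φ a = a := if_neg hD.2
          exact ⟨a, hD.1, e.symm ▸ .refl, a, hD.1, e.symm ▸ .refl⟩
      refine reflTransGen_of_lift (R := fun x y => (z, x, y) ∈ T) (D := fun a => ∃ c, (z, a, c) ∈ T)
        φ ?_ ?_ ?_ ?_
      · rintro a b ⟨c, hc⟩ ⟨d, hd⟩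
        exact h.link hc hd
      · intro a b hab
        by_cases hr : (z, a, b) ∈ rotations u v x ∪ rotations v u y
        · simp only [Finset.mem_union, mem_rotations, Prod.mk.injEq] at hr
          rcases hr with (⟨rfl, rfl, rfl⟩ | ⟨rfl, rfl, rfl⟩ | ⟨rfl, rfl, rfl⟩) |
            (⟨rfl, rfl, rfl⟩ | ⟨rfl, rfl, rfl⟩ | ⟨rfl, rfl, rfl⟩)
          · have e : φ a = n := by rcases hφ a with h | h <;> omega
            have e' : φ b = b := by rcases hφ b with h | h <;> omega
            rw [e, e']; exact wstep _ _ (by simp [mem_subdivide])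
          · have e : φ a = a := by rcases hφ a with h | h <;> omega
            have e' : φ b = n := by rcases hφ b with h | h <;> omega
            rw [e, e']; exact wstep _ _ (by simp [mem_subdivide])
          · have e : φ a = a := by rcases hφ a with h | h <;> omega
            have e' : φ b = b := by rcases hφ b with h | h <;> omega
            rw [e, e']
            exact (wstep _ n (by simp [mem_subdivide])).trans (wstep _ _ (by simp [mem_subdivide]))
          · have e : φ a = n := by rcases hφ a with h | h <;> omega
            have e' : φ b = b := by rcases hφ b with h | h <;> omega
            rw [e, e']; exact wstep _ _ (by simp [mem_subdivide])
          · have e : φ a = a := by rcases hφ a with h | h <;> omega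
            have e' : φ b = n := by rcases hφ b with h | h <;> omega
            rw [e, e']; exact wstep _ _ (by simp [mem_subdivide])
          · have e : φ a = a := by rcases hφ a with h | h <;> omega
            have e' : φ b = b := by rcases hφ b with h | h <;> omega
            rw [e, e']
            exact (wstep _ n (by simp [mem_subdivide])).trans (wstep _ _ (by simp [mem_subdivide]))
        · have hn : (z, a, b) ∈ PlanarAntiRamsey.subdivide T u v x y n :=
            mem_subdivide.2 (Or.inl ⟨hab, by simpa only [Finset.mem_union, mem_rotations] using hr⟩)
          simp only [Finset.mem_union, mem_rotations, Prod.mk.injEq] at hr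
          have ea : φ a = a := by
            refine if_neg ?_
            rintro (⟨rfl, rfl⟩ | ⟨rfl, rfl⟩)
            · have := h.unique hab hx; omega
            · have := h.unique hab hy; omega
          have hba := h.cyc (h.cyc hab)
          have eb : φ b = b := by
            refine if_neg ?_
            rintro (⟨rfl, rfl⟩ | ⟨rfl, rfl⟩)
            · have := h.unique hba hy; omega
            · have := h.unique hba hx; omega
          rw [ea, eb]; exact wstep _ _ hn
      · obtain ⟨s, hs, h1, -⟩ := nb ha
        exact ⟨s, hs, h1⟩
      · obtain ⟨-, -, -, s, hs, h1⟩ := nb hb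
        exact ⟨s, hs, h1⟩
  · intro a b ha hb
    have e1 : ∃ c, (u, n, c) ∈ PlanarAntiRamsey.subdivide T u v x y n :=
      ⟨x, mem_subdivide.2 (by simp)⟩
    have e2 : ∃ c, (n, v, c) ∈ PlanarAntiRamsey.subdivide T u v x y n :=
      ⟨x, mem_subdivide.2 (by simp)⟩
    have e3 : ∃ c, (v, n, c) ∈ PlanarAntiRamsey.subdivide T u v x y n :=
      ⟨y, mem_subdivide.2 (by simp)⟩
    have e4 : ∃ c, (n, u, c) ∈ PlanarAntiRamsey.subdivide T u v x y n :=
      ⟨y, mem_subdivide.2 (by simp)⟩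
    have old : ∀ {a b}, a < n → b < n → ReflTransGen (fun x_1 y_1 => ∃ c, (x_1, y_1, c) ∈
        PlanarAntiRamsey.subdivide T u v x y n) a b := by
      intro a b ha hb
      refine ReflTransGen.lift' id ?_ _ _ (h.conn ha hb)
      rintro p q ⟨c, hc⟩
      by_cases hpq : (p = u ∧ q = v) ∨ (p = v ∧ q = u)
      · rcases hpq with ⟨rfl, rfl⟩ | ⟨rfl, rfl⟩
        · exact (ReflTransGen.single e1).tail e2
        · exact (ReflTransGen.single e3).tail e4
      · exact .single (keep hc hpq)
    rcases Nat.lt_succ_iff_lt_or_eq.1 ha with ha | rfl <;>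
      rcases Nat.lt_succ_iff_lt_or_eq.1 hb with hb | rfl
    · exact old ha hb
    · exact (old ha hu).tail e1
    · exact (old hu hb).head e4
    · exact .refl
  · have := h.sum_subdivide hx hy (fun _ => 1) (fun _ _ _ _ => rfl)
    have hc := h.card
    simp only [← Finset.card_eq_sum_ones] at this
    omega

end IsTriangulation

end PlanarAntiRamsey

/-! ### From oriented triangles to plane graphs -/

namespace PlanarAntiRamsey

open Relation SimpleGraph

/-- The faces of a rotation system all of whose faces are triangles number a third of the darts. -/
theorem card_face_mul_three {V : Type*} [Finite V] {G : SimpleGraph V} (R : RotationSystem G)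
    (h : ∀ d, R.faceSize d = 3) : Nat.card R.Face * 3 = Nat.card G.Dart := by
  classical
  have : Fintype V := Fintype.ofFinite V
  have : Fintype G.Dart := Fintype.ofFinite _
  let : Fintype R.Face := Quotient.fintype (Equiv.Perm.SameCycle.setoid R.facePerm)
  rw [Nat.card_eq_fintype_card, Nat.card_eq_fintype_card]
  have hmaps : ∀ d ∈ (Finset.univ : Finset G.Dart),
      (Quotient.mk (Equiv.Perm.SameCycle.setoid R.facePerm) d : R.Face) ∈
        (Finset.univ : Finset R.Face) := fun _ _ => Finset.mem_univ _
  have hsum := Finset.card_eq_sum_card_fiberwise hmaps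
  rw [← Finset.card_univ, ← Finset.card_univ, hsum, ← smul_eq_mul, ← Finset.sum_const]
  refine Finset.sum_congr rfl fun F _ => ?_
  obtain ⟨d, rfl⟩ := Quotient.exists_rep F
  rw [← h d, RotationSystem.faceSize, ← Set.ncard_coe_finset]
  congr 1
  ext e
  simp only [Set.mem_ofPred_eq, Finset.coe_filter, Finset.mem_univ, true_and]
  constructor
  · exact fun hde => Quotient.sound hde.symm
  · exact fun hed => (Quotient.exact hed : R.facePerm.SameCycle e d).symm

namespace IsTriangulation

variable {n : ℕ} {T : Finset (ℕ × ℕ × ℕ)}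

/-- The graph of the edges of the triangles in `T`. -/
def graph (h : IsTriangulation n T) : SimpleGraph (Fin n) where
  Adj a b := ∃ c, ((a : ℕ), (b : ℕ), c) ∈ T
  symm := ⟨fun _ _ ⟨_, hc⟩ => h.symm hc⟩
  loopless := ⟨fun _ ⟨_, hc⟩ => h.ne hc rfl⟩

theorem graph_adj (h : IsTriangulation n T) {a b : Fin n} :
    h.graph.Adj a b ↔ ∃ c, ((a : ℕ), (b : ℕ), c) ∈ T := Iff.rfl

theorem exists_next (h : IsTriangulation n T) (d : h.graph.Dart) :
    ∃ e : h.graph.Dart, e.fst = d.snd ∧ ((d.fst : ℕ), (d.snd : ℕ), (e.snd : ℕ)) ∈ T := by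
  obtain ⟨c, hc⟩ := h.graph_adj.1 d.adj
  exact ⟨⟨(d.snd, ⟨c, h.lt₃ hc⟩), ⟨_, h.cyc hc⟩⟩, rfl, hc⟩

/-- The dart after `d` on the triangle that lies along `d`. -/
noncomputable def next (h : IsTriangulation n T) (d : h.graph.Dart) : h.graph.Dart :=
  (h.exists_next d).choose

theorem next_fst (h : IsTriangulation n T) (d : h.graph.Dart) : (h.next d).fst = d.snd :=
  (h.exists_next d).choose_spec.1

theorem next_mem (h : IsTriangulation n T) (d : h.graph.Dart) :
    ((d.fst : ℕ), (d.snd : ℕ), ((h.next d).snd : ℕ)) ∈ T :=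
  (h.exists_next d).choose_spec.2

theorem next_snd_eq (h : IsTriangulation n T) (d : h.graph.Dart) {c : Fin n}
    (hc : ((d.fst : ℕ), (d.snd : ℕ), (c : ℕ)) ∈ T) : (h.next d).snd = c :=
  Fin.ext (h.unique (h.next_mem d) hc)

theorem next_next_snd (h : IsTriangulation n T) (d : h.graph.Dart) :
    (h.next (h.next d)).snd = d.fst := by
  refine h.next_snd_eq _ ?_
  rw [h.next_fst]
  exact h.cyc (h.next_mem d)

theorem next_next_next (h : IsTriangulation n T) (d : h.graph.Dart) :
    h.next (h.next (h.next d)) = d := by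
  refine Dart.ext _ _ (Prod.ext ?_ ?_)
  · exact (h.next_fst _).trans (h.next_next_snd d)
  · refine (h.next_next_snd _).trans (h.next_fst d)

/-- The permutation of the darts that runs around the triangles. -/
noncomputable def nextPerm (h : IsTriangulation n T) : Equiv.Perm h.graph.Dart where
  toFun := h.next
  invFun d := h.next (h.next d)
  left_inv := h.next_next_next
  right_inv := h.next_next_next

/-- The rotation system of a triangulation. -/
noncomputable def rotationSystem (h : IsTriangulation n T) : RotationSystem h.graph where
  rot := (Dart.symm_involutive (G := h.graph)).toPerm.trans h.nextPerm
  fst_rot d := h.next_fst d.symm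
  sameCycle_of_fst_eq := by
    set σ : Equiv.Perm h.graph.Dart :=
      (Dart.symm_involutive (G := h.graph)).toPerm.trans h.nextPerm with hσ
    -- `σ` turns against the link relation: if `(v, b, c) ∈ T`, it sends the dart `v → c` to `v →
    -- b`. Hence one application of `σ` undoes the last link step.
    have key : ∀ (v a b : ℕ), ReflTransGen (fun x y => (v, x, y) ∈ T) a b →
        ∀ d e : h.graph.Dart, (d.fst : ℕ) = v → (d.snd : ℕ) = a → (e.fst : ℕ) = v →
          (e.snd : ℕ) = b → σ.SameCycle e d := by
      intro v a b hab
      induction hab with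
      | refl =>
        intro d e h1 h2 h3 h4
        have : e = d := Dart.ext _ _ (Prod.ext (Fin.ext (h3.trans h1.symm)) (Fin.ext (h4.trans h2.symm)))
        rw [this]
      | @tail b c _ hbc ih =>
        intro d e h1 h2 h3 h4
        have hv := h.lt hbc
        have hb := h.lt₂ hbc
        let e' : h.graph.Dart := ⟨(⟨v, hv⟩, ⟨b, hb⟩), ⟨c, hbc⟩⟩
        have hstep : σ e = e' := by
          refine Dart.ext _ _ (Prod.ext ?_ ?_)
          · exact (h.next_fst e.symm).trans (Fin.ext h3)
          · refine h.next_snd_eq e.symm (c := ⟨b, hb⟩) ?_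
            have : ((e.symm.fst : ℕ), (e.symm.snd : ℕ), b) = (c, v, b) := by
              simp [← h3, ← h4]
            change ((e.symm.fst : ℕ), (e.symm.snd : ℕ), b) ∈ T
            rw [this]
            exact h.cyc (h.cyc hbc)
        have := ih d e' h1 h2 rfl rfl
        rw [← hstep] at this
        exact Equiv.Perm.sameCycle_apply_left.1 this
    intro d e hde
    obtain ⟨c, hc⟩ := d.adj
    obtain ⟨c', hc'⟩ := e.adj
    have he : (e.fst : ℕ) = d.fst := congrArg Fin.val hde.symm
    rw [he] at hc'
    exact key d.fst e.snd d.snd (h.link hc' hc) e d he rfl rfl rfl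

theorem facePerm_rotationSystem (h : IsTriangulation n T) (d : h.graph.Dart) :
    h.rotationSystem.facePerm d = h.next d := by
  change h.next d.symm.symm = h.next d
  rw [Dart.symm_symm]

theorem faceSize_rotationSystem (h : IsTriangulation n T) (d : h.graph.Dart) :
    h.rotationSystem.faceSize d = 3 := by
  have hset : {e | h.rotationSystem.facePerm.SameCycle d e} =
      ({d, h.next d, h.next (h.next d)} : Set h.graph.Dart) := by
    have hpow : ∀ m : ℕ, (h.rotationSystem.facePerm ^ m) d ∈
        ({d, h.next d, h.next (h.next d)} : Set h.graph.Dart) := by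
      intro m
      induction m with
      | zero => simp
      | succ m ih =>
        rw [pow_succ', Equiv.Perm.mul_apply, h.facePerm_rotationSystem]
        rcases ih with ih | ih | ih <;> rw [ih] <;> simp [h.next_next_next]
    ext e
    constructor
    · intro he
      have : Finite h.graph.Dart := Finite.of_injective _ (Dart.toProd_injective (G := h.graph))
      obtain ⟨m, -, rfl⟩ := Equiv.Perm.SameCycle.exists_pow_eq' he
      exact hpow m
    · have h1 : h.rotationSystem.facePerm.SameCycle d (h.next d) := by
        rw [← h.facePerm_rotationSystem]
        exact Equiv.Perm.sameCycle_apply_right.2 (Equiv.Perm.SameCycle.refl _ _)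
      have h2 : h.rotationSystem.facePerm.SameCycle d (h.next (h.next d)) := by
        rw [← h.facePerm_rotationSystem]
        exact Equiv.Perm.sameCycle_apply_right.2 h1
      rintro (rfl | rfl | rfl)
      exacts [Equiv.Perm.SameCycle.refl _ _, h1, h2]
  rw [RotationSystem.faceSize, hset, Set.ncard_eq_three]
  refine ⟨_, _, _, ?_, ?_, ?_, rfl⟩
  · intro he
    exact d.adj.ne (by rw [← h.next_fst d, ← he])
  · intro he
    refine d.adj.ne ?_
    rw [← h.next_next_snd d, ← he]
  · intro he
    refine (h.next d).adj.ne ?_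
    rw [← h.next_fst (h.next d), ← he]

/-- By `unique`, a dart extends to exactly one triple of `T`. -/
theorem card_dart (h : IsTriangulation n T) : Nat.card h.graph.Dart = T.card := by
  rw [← Fintype.card_coe T, ← Nat.card_eq_fintype_card]
  let f : h.graph.Dart → T := fun d => ⟨_, h.next_mem d⟩
  refine Nat.card_eq_of_bijective f ⟨?_, ?_⟩
  · intro d e hde
    simp only [f, Subtype.mk.injEq, Prod.mk.injEq] at hde
    exact Dart.ext _ _ (Prod.ext (Fin.ext hde.1) (Fin.ext hde.2.1))
  · rintro ⟨⟨a, b, c⟩, ht⟩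
    refine ⟨⟨(⟨a, h.lt ht⟩, ⟨b, h.lt₂ ht⟩), ⟨c, ht⟩⟩, ?_⟩
    simp only [f, Subtype.mk.injEq, Prod.mk.injEq, true_and]
    exact h.unique (h.next_mem _) ht

theorem connected (h : IsTriangulation n T) (hn : 0 < n) : h.graph.Connected := by
  have : Nonempty (Fin n) := ⟨⟨0, hn⟩⟩
  refine ⟨fun a b => ?_⟩
  have key : ∀ x y : ℕ, ReflTransGen (fun x y => ∃ c, (x, y, c) ∈ T) x y →
      ∀ (hx : x < n) (hy : y < n), h.graph.Reachable ⟨x, hx⟩ ⟨y, hy⟩ := by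
    intro x y hxy
    induction hxy with
    | refl => intro _ _; rfl
    | tail _ hbc ih =>
      intro hx hy
      obtain ⟨d, hd⟩ := hbc
      exact (ih hx (h.lt hd)).trans (Adj.reachable ⟨d, hd⟩)
  exact key a b (h.conn a.2 b.2) a.2 b.2

/-- Euler's formula holds because `3F = 2E = |T| = 6n - 12`, that is, `E = 3n - 6` and `F = 2n - 4`.
-/
theorem isPlaneTriangulation (h : IsTriangulation n T) (hn : 3 ≤ n) :
    h.graph.IsPlaneTriangulation := by
  classical
  refine ⟨by simpa using hn, h.connected (by omega), h.rotationSystem, ?_,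
    h.faceSize_rotationSystem⟩
  have h1 := card_face_mul_three h.rotationSystem h.faceSize_rotationSystem
  have h2 := h.graph.dart_card_eq_twice_card_edges
  have h3 : h.graph.edgeSet.ncard = h.graph.edgeFinset.card := by
    rw [← SimpleGraph.coe_edgeFinset, Set.ncard_coe_finset]
  have h4 := h.card_dart
  have h5 := h.card
  rw [Nat.card_eq_fintype_card] at h4
  rw [Nat.card_eq_fintype_card (α := h.graph.Dart)] at h1
  rw [RotationSystem.IsPlane, h3, Nat.card_eq_fintype_card, Fintype.card_fin]
  omega

end IsTriangulation

end PlanarAntiRamsey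

/-! ### Frames: triangulations with poles and blocks -/

namespace PlanarAntiRamsey

/-- The weight of a dart in the count of the edges that avoid `P`: every such edge is counted at
one of its two darts. -/
def edgeWeight (P : Finset ℕ) (t : ℕ × ℕ × ℕ) : ℕ :=
  if t.1 < t.2.1 ∧ t.1 ∉ P ∧ t.2.1 ∉ P then 1 else 0

/-- A triangulation `T` on the vertices `0, …, n - 1` with a set `P` of poles. The `e` edges that
avoid the poles are covered by a `k`-spread family of blocks `B` with weights `W`, of which only
the first `L` are in use. -/
structure Frame (k n : ℕ) (T : Finset (ℕ × ℕ × ℕ)) (P : Finset ℕ) (B : ℕ → Finset ℕ) (W : ℕ → ℕ)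
    (L e : ℕ) : Prop where
  tri : IsTriangulation n T
  -- The edge to such an `a` has `p` as its largest pole, so the color of `p` is really used.
  pole : ∀ p ∈ P, p < n ∧ ∃ a c, (p, a, c) ∈ T ∧ (a ∉ P ∨ a < p)
  block : ∀ l, ∀ a ∈ B l, a < n ∧ a ∉ P
  cover : ∀ {a b c}, (a, b, c) ∈ T → a ∉ P → b ∉ P → ∃ l, a ∈ B l ∧ b ∈ B l
  spread : Spread k B W
  small : ∀ l, (B l).card < k
  -- The index `L` is thus always free for the block that a subdivision creates. The default weights
  -- are at most one because `Spread.not_cycle` asks this of every index.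
  unused : ∀ l, L ≤ l → B l = ∅ ∧ W l ≤ 1
  edges : ∑ t ∈ T, edgeWeight P t = e

/-- A path `u = c 0, …, c (j - 1) = x` on `j` vertices in the graph of `T`. -/
def HasPath (n : ℕ) (T : Finset (ℕ × ℕ × ℕ)) (j u x : ℕ) : Prop :=
  ∃ c : ℕ → ℕ, c 0 = u ∧ c (j - 1) = x ∧ Set.InjOn c (Set.Iio j) ∧ (∀ i < j, c i < n) ∧
    ∀ i, i + 1 < j → ∃ d, (c i, c (i + 1), d) ∈ T

/-- The new vertex is adjacent to both `x` and `u`, so a cycle that closes along `xu` can be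
rerouted through it and gains one vertex. -/
theorem HasPath.stack {n : ℕ} {T : Finset (ℕ × ℕ × ℕ)} {j u x : ℕ} (h : HasPath n T j u x)
    (hj : 0 < j) (v : ℕ) : HasPath (n + 1) (stack T u v x n) (j + 1) u n := by
  obtain ⟨c, h0, h1, hinj, hlt, hadj⟩ := h
  refine ⟨Function.update c j n, ?_, by simp, ?_, ?_, ?_⟩
  · rw [Function.update_of_ne hj.ne, h0]
  · intro a ha b hb hab
    simp only [Set.mem_Iio] at ha hb
    by_cases haj : a = j <;> by_cases hbj : b = j
    · rw [haj, hbj]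
    · rw [haj, Function.update_self, Function.update_of_ne hbj] at hab
      exact absurd hab.symm (hlt b (by omega)).ne
    · rw [hbj, Function.update_self, Function.update_of_ne haj] at hab
      exact absurd hab (hlt a (by omega)).ne
    · rw [Function.update_of_ne haj, Function.update_of_ne hbj] at hab
      exact hinj (by simp; omega) (by simp; omega) hab
  · intro i hi
    by_cases hij : i = j
    · simp [hij]
    · rw [Function.update_of_ne hij]
      exact (hlt i (by omega)).trans n.lt_succ_self
  · intro i hi
    have hij : i ≠ j := by omega
    rw [Function.update_of_ne hij]
    by_cases hij' : i + 1 = j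
    · rw [hij', Function.update_self]
      have : c i = x := by rw [← h1]; congr 1; omega
      rw [this]
      exact ⟨v, by simp [mem_stack]⟩
    · rw [Function.update_of_ne hij']
      obtain ⟨d, hd⟩ := hadj i (by omega)
      exact IsTriangulation.adj_stack hd

namespace Frame

variable {k n : ℕ} {T : Finset (ℕ × ℕ × ℕ)} {P : Finset ℕ} {B : ℕ → Finset ℕ} {W : ℕ → ℕ}
  {L e : ℕ}

theorem not_mem_pole (h : Frame k n T P B W L e) : n ∉ P :=
  fun hn => (h.pole n hn).1.false

theorem not_mem_block (h : Frame k n T P B W L e) (l : ℕ) : n ∉ B l :=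
  fun hn => (h.block l n hn).1.false

theorem lt_of_mem (h : Frame k n T P B W L e) {l a : ℕ} (ha : a ∈ B l) : l < L := by
  by_contra! hl
  simp [(h.unused l hl).1] at ha

/-- Insert a vertex into a triangle two corners of which lie in a block, and the third one is a
pole or lies in that block, too. -/
theorem grow (h : Frame k n T P B W L e) {u v x l : ℕ} (hx : (u, v, x) ∈ T) (hu : u ∈ B l)
    (hv : v ∈ B l) (hxP : x ∈ P ∨ x ∈ B l) (hl : (B l).card + 1 < k) :
    Frame k (n + 1) (stack T u v x n) P (Function.update B l (insert n (B l))) W L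
      (e + if x ∈ P then 2 else 3) := by
  have hn := h.not_mem_block
  have hmem : ∀ m a, a ∈ B m → a ∈ Function.update B l (insert n (B l)) m := by
    intro m a ha
    by_cases hm : m = l
    · subst hm; simp [ha]
    · simpa [hm] using ha
  refine ⟨h.tri.stack hx, ?_, ?_, ?_, h.spread.insert hu hn, ?_, ?_, ?_⟩
  · intro p hp
    obtain ⟨h1, a, c, h2, h3⟩ := h.pole p hp
    obtain ⟨d, hd⟩ := IsTriangulation.adj_stack (n := n) (u := u) (v := v) (x := x) h2
    exact ⟨by omega, a, d, hd, h3⟩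
  · intro m a ha
    by_cases hm : m = l
    · subst hm
      simp only [Function.update_self, Finset.mem_insert] at ha
      rcases ha with rfl | ha
      · exact ⟨by omega, h.not_mem_pole⟩
      · have := h.block _ _ ha
        exact ⟨by omega, this.2⟩
    · rw [Function.update_of_ne hm] at ha
      have := h.block _ _ ha
      exact ⟨by omega, this.2⟩
  · intro a b c ht ha hb
    have old : ∀ {a b c}, (a, b, c) ∈ T → a ∉ P → b ∉ P →
        ∃ m, a ∈ Function.update B l (insert n (B l)) m ∧
          b ∈ Function.update B l (insert n (B l)) m := by
      intro a b c ht ha hb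
      obtain ⟨m, h1, h2⟩ := h.cover ht ha hb
      exact ⟨m, hmem _ _ h1, hmem _ _ h2⟩
    have hnew : ∀ a b, (a = n ∨ a ∈ B l) → (b = n ∨ b ∈ B l) →
        ∃ m, a ∈ Function.update B l (insert n (B l)) m ∧
          b ∈ Function.update B l (insert n (B l)) m :=
      fun a b ha hb => ⟨l, by simpa using ha, by simpa using hb⟩
    rcases mem_stack.1 ht with ⟨h1, -⟩ | h1
    · exact old h1 ha hb
    · simp only [Prod.mk.injEq] at h1
      rcases h1 with (⟨rfl, rfl, rfl⟩ | ⟨rfl, rfl, rfl⟩ | ⟨rfl, rfl, rfl⟩) |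
        (⟨rfl, rfl, rfl⟩ | ⟨rfl, rfl, rfl⟩ | ⟨rfl, rfl, rfl⟩) |
        (⟨rfl, rfl, rfl⟩ | ⟨rfl, rfl, rfl⟩ | ⟨rfl, rfl, rfl⟩)
      · exact old hx ha hb
      · exact hnew _ _ (.inr hv) (.inl rfl)
      · exact hnew _ _ (.inl rfl) (.inr hu)
      · exact old (h.tri.cyc hx) ha hb
      · exact hnew _ _ (.inr (hxP.resolve_left ha)) (.inl rfl)
      · exact hnew _ _ (.inl rfl) (.inr hv)
      · exact old (h.tri.cyc (h.tri.cyc hx)) ha hb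
      · exact hnew _ _ (.inr hu) (.inl rfl)
      · exact hnew _ _ (.inl rfl) (.inr (hxP.resolve_left hb))
  · intro m
    by_cases hm : m = l
    · subst hm
      simpa [hn m] using hl
    · simpa [hm] using h.small m
  · intro m hm
    have : m ≠ l := by
      have := h.lt_of_mem hu
      omega
    simpa [this] using h.unused m hm
  · have hs := h.tri.sum_stack hx (edgeWeight P) (fun _ _ _ _ => rfl)
    have h1 := h.tri.lt hx
    have h2 := h.tri.lt₂ hx
    have h3 := h.tri.lt₃ hx
    have h4 := (h.block _ _ hu).2
    have h5 := (h.block _ _ hv).2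
    rw [hs, h.edges]
    simp only [edgeWeight, h1, h2, h3, h4, h5, h1.not_gt, h2.not_gt, h3.not_gt, h.not_mem_pole]
    by_cases hxP' : x ∈ P <;> simp [hxP']

/-- Insert a pole into a triangle. -/
theorem addPole (h : Frame k n T P B W L e) {u v x : ℕ} (hx : (u, v, x) ∈ T) :
    Frame k (n + 1) (stack T u v x n) (insert n P) B W L e := by
  have h1 := h.tri.lt hx
  have h2 := h.tri.lt₂ hx
  have h3 := h.tri.lt₃ hx
  refine ⟨h.tri.stack hx, ?_, ?_, ?_, h.spread, h.small, h.unused, ?_⟩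
  · intro p hp
    rcases Finset.mem_insert.1 hp with rfl | hp
    -- The neighbors of a new pole may be poles, too, but their labels are smaller.
    · exact ⟨by omega, u, v, by simp [mem_stack], .inr h1⟩
    · obtain ⟨h4, a, c, h5, h6⟩ := h.pole p hp
      obtain ⟨d, hd⟩ := IsTriangulation.adj_stack (n := n) (u := u) (v := v) (x := x) h5
      have := h.tri.lt₂ h5
      refine ⟨by omega, a, d, hd, ?_⟩
      rcases h6 with h6 | h6
      · exact .inl (by simp [h6, this.ne])
      · exact .inr h6
  · intro l a ha
    have := h.block l a ha
    exact ⟨by omega, by simp [this.2, this.1.ne]⟩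
  · intro a b c ht ha hb
    rw [Finset.mem_insert, not_or] at ha hb
    rcases mem_stack.1 ht with ⟨h1, -⟩ | h1
    · exact h.cover h1 ha.2 hb.2
    · simp only [Prod.mk.injEq] at h1
      have hx1 := h.tri.cyc hx
      have hx2 := h.tri.cyc hx1
      rcases h1 with (⟨rfl, rfl, rfl⟩ | ⟨rfl, rfl, rfl⟩ | ⟨rfl, rfl, rfl⟩) |
        (⟨rfl, rfl, rfl⟩ | ⟨rfl, rfl, rfl⟩ | ⟨rfl, rfl, rfl⟩) |
        (⟨rfl, rfl, rfl⟩ | ⟨rfl, rfl, rfl⟩ | ⟨rfl, rfl, rfl⟩)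
      · exact h.cover hx ha.2 hb.2
      · exact absurd rfl hb.1
      · exact absurd rfl ha.1
      · exact h.cover hx1 ha.2 hb.2
      · exact absurd rfl hb.1
      · exact absurd rfl ha.1
      · exact h.cover hx2 ha.2 hb.2
      · exact absurd rfl hb.1
      · exact absurd rfl ha.1
  · have hs := h.tri.sum_stack hx (edgeWeight (insert n P)) (fun _ _ _ _ => rfl)
    rw [hs]
    have hsum : ∑ t ∈ T, edgeWeight (insert n P) t = ∑ t ∈ T, edgeWeight P t := by
      refine Finset.sum_congr rfl ?_
      rintro ⟨a, b, c⟩ ht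
      have h4 := (h.tri.lt ht).ne
      have h5 := (h.tri.lt₂ ht).ne
      simp [edgeWeight, h4, h5]
    rw [hsum, h.edges]
    simp [edgeWeight]

/-- Subdivide an edge that is a block of its own and has poles on both sides. -/
theorem split (h : Frame k n T P B W L e) {u v x y l s t : ℕ} (hB : B l = {u, v})
    (hx : (u, v, x) ∈ T) (hy : (v, u, y) ∈ T) (hxy : x ≠ y) (hxP : x ∈ P) (hyP : y ∈ P)
    (hW : W l = s + t) :
    Frame k (n + 1) (subdivide T u v x y n) P
      (Function.update (Function.update B l {u, n}) L {n, v})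
      (Function.update (Function.update W l s) L t) (L + 1) (e + 1) := by
  have huv := h.tri.ne hx
  have hu : u ∈ B l := by simp [hB]
  have hv : v ∈ B l := by simp [hB]
  have hlL := h.lt_of_mem hu
  have hun := (h.block _ _ hu).1
  have hvn := (h.block _ _ hv).1
  have huP := (h.block _ _ hu).2
  have hvP := (h.block _ _ hv).2
  have hxn := h.tri.lt₃ hx
  have hyn := h.tri.lt₃ hy
  have hk : 2 < k := by
    have := h.small l
    rwa [hB, Finset.card_pair huv] at this
  have hmem : ∀ a b, (∃ m, a ∈ B m ∧ b ∈ B m) → ¬ ((a = u ∧ b = v) ∨ (a = v ∧ b = u)) →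
      a ≠ b → ∃ m, a ∈ Function.update (Function.update B l {u, n}) L {n, v} m ∧
        b ∈ Function.update (Function.update B l {u, n}) L {n, v} m := by
    rintro a b ⟨m, ha, hb⟩ hab hne
    have hmL := h.lt_of_mem ha
    have hml : m ≠ l := by
      rintro rfl
      simp only [hB, Finset.mem_insert, Finset.mem_singleton] at ha hb
      omega
    refine ⟨m, ?_, ?_⟩ <;> simpa [hmL.ne, hml]
  refine ⟨h.tri.subdivide hx hy hxy, ?_, ?_, ?_,
    h.spread.subdivide hB huv hW hlL.ne' (h.unused L le_rfl).1 h.not_mem_block, ?_, ?_, ?_⟩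
  · intro p hp
    obtain ⟨h1, a, c, h2, h3⟩ := h.pole p hp
    have hpu : p ≠ u := fun h => huP (h ▸ hp)
    have hpv : p ≠ v := fun h => hvP (h ▸ hp)
    by_cases hr : (p, a, c) ∈ rotations u v x ∪ rotations v u y
    · refine ⟨by omega, a, n, mem_subdivide.2 (Or.inr ?_), h3⟩
      simp only [Finset.mem_union, mem_rotations, Prod.mk.injEq] at hr
      rcases hr with (⟨rfl, rfl, rfl⟩ | ⟨rfl, rfl, rfl⟩ | ⟨rfl, rfl, rfl⟩) |
        (⟨rfl, rfl, rfl⟩ | ⟨rfl, rfl, rfl⟩ | ⟨rfl, rfl, rfl⟩) <;> simp at hpu hpv ⊢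
    · refine ⟨by omega, a, c, mem_subdivide.2 (Or.inl ⟨h2, ?_⟩), h3⟩
      simpa only [Finset.mem_union, mem_rotations] using hr
  · intro m a ha
    by_cases hmL : m = L
    · subst hmL
      simp only [Function.update_self, Finset.mem_insert, Finset.mem_singleton] at ha
      rcases ha with rfl | rfl
      · exact ⟨by omega, h.not_mem_pole⟩
      · exact ⟨by omega, hvP⟩
    rw [Function.update_of_ne hmL] at ha
    by_cases hml : m = l
    · subst hml
      simp only [Function.update_self, Finset.mem_insert, Finset.mem_singleton] at ha
      rcases ha with rfl | rfl
      · exact ⟨by omega, huP⟩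
      · exact ⟨by omega, h.not_mem_pole⟩
    · rw [Function.update_of_ne hml] at ha
      have := h.block _ _ ha
      exact ⟨by omega, this.2⟩
  · intro a b c ht ha hb
    have c1 : ∀ a b, (a = u ∨ a = n) → (b = u ∨ b = n) →
        ∃ m, a ∈ Function.update (Function.update B l {u, n}) L {n, v} m ∧
          b ∈ Function.update (Function.update B l {u, n}) L {n, v} m :=
      fun a b ha hb => ⟨l, by simpa [hlL.ne] using ha, by simpa [hlL.ne] using hb⟩
    have c2 : ∀ a b, (a = n ∨ a = v) → (b = n ∨ b = v) →
        ∃ m, a ∈ Function.update (Function.update B l {u, n}) L {n, v} m ∧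
          b ∈ Function.update (Function.update B l {u, n}) L {n, v} m :=
      fun a b ha hb => ⟨L, by simpa using ha, by simpa using hb⟩
    rcases mem_subdivide.1 ht with ⟨h1, h2⟩ | h1
    · refine hmem a b (h.cover h1 ha hb) ?_ (h.tri.ne h1)
      rintro (⟨rfl, rfl⟩ | ⟨rfl, rfl⟩)
      · simp [h.tri.unique h1 hx] at h2
      · simp [h.tri.unique h1 hy] at h2
    · simp only [Prod.mk.injEq] at h1
      rcases h1 with ((⟨rfl, rfl, rfl⟩ | ⟨rfl, rfl, rfl⟩ | ⟨rfl, rfl, rfl⟩) |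
        (⟨rfl, rfl, rfl⟩ | ⟨rfl, rfl, rfl⟩ | ⟨rfl, rfl, rfl⟩)) |
        ((⟨rfl, rfl, rfl⟩ | ⟨rfl, rfl, rfl⟩ | ⟨rfl, rfl, rfl⟩) |
        (⟨rfl, rfl, rfl⟩ | ⟨rfl, rfl, rfl⟩ | ⟨rfl, rfl, rfl⟩))
      · exact c1 _ _ (.inl rfl) (.inr rfl)
      · exact absurd hxP hb
      · exact absurd hxP ha
      · exact c2 _ _ (.inl rfl) (.inr rfl)
      · exact absurd hxP hb
      · exact absurd hxP ha
      · exact c2 _ _ (.inr rfl) (.inl rfl)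
      · exact absurd hyP hb
      · exact absurd hyP ha
      · exact c1 _ _ (.inr rfl) (.inl rfl)
      · exact absurd hyP hb
      · exact absurd hyP ha
  · intro m
    by_cases hmL : m = L
    · subst hmL
      rw [Function.update_self]
      exact Finset.card_le_two.trans_lt hk
    rw [Function.update_of_ne hmL]
    by_cases hml : m = l
    · subst hml
      rw [Function.update_self]
      exact Finset.card_le_two.trans_lt hk
    · rw [Function.update_of_ne hml]
      exact h.small m
  · intro m hm
    have h1 : m ≠ L := by omega
    have h2 : m ≠ l := by omega
    simpa [h1, h2] using h.unused m (by omega)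
  -- One counted edge is replaced by two; the new edges to `x` and `y` end in poles and do not
  -- count.
  · have hs := h.tri.sum_subdivide hx hy (edgeWeight P) (fun _ _ _ _ => rfl)
    rw [h.edges] at hs
    generalize ∑ t ∈ subdivide T u v x y n, edgeWeight P t = S at hs ⊢
    simp only [edgeWeight, hun, hvn, hxn, hyn, huP, hvP, hxP, hyP, hun.not_gt, hvn.not_gt,
      h.not_mem_pole] at hs
    rcases huv.lt_or_gt with h1 | h1 <;> simp [h1, h1.not_gt] at hs <;> omega

end Frame

end PlanarAntiRamsey

/-! ### Filling the blocks -/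

namespace PlanarAntiRamsey

theorem mem_stack_of_mem {T : Finset (ℕ × ℕ × ℕ)} {u v x w : ℕ} {t : ℕ × ℕ × ℕ} (ht : t ∈ T)
    (hr : t ∉ rotations u v x) : t ∈ stack T u v x w :=
  mem_stack.2 (.inl ⟨ht, by rwa [← mem_rotations]⟩)

theorem mem_subdivide_of_mem {T : Finset (ℕ × ℕ × ℕ)} {u v x y w : ℕ} {t : ℕ × ℕ × ℕ} (ht : t ∈ T)
    (hr : t ∉ rotations u v x) (hr' : t ∉ rotations v u y) : t ∈ subdivide T u v x y w :=
  mem_subdivide.2 (.inl ⟨ht, by rw [← mem_rotations, ← mem_rotations]; tauto⟩)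

namespace IsTriangulation

theorem not_mem_rotations {n : ℕ} {T : Finset (ℕ × ℕ × ℕ)} (h : IsTriangulation n T)
    {t : ℕ × ℕ × ℕ} (ht : t ∈ T) (a b : ℕ) : t ∉ rotations a b n ∧ t ∉ rotations a n b := by
  obtain ⟨p, q, r⟩ := t
  have h1 := (h.lt ht).ne
  have h2 := (h.lt₂ ht).ne
  have h3 := (h.lt₃ ht).ne
  simp [mem_rotations, h1, h2, h3]

end IsTriangulation

namespace Frame

variable {k n : ℕ} {T : Finset (ℕ × ℕ × ℕ)} {P : Finset ℕ} {B : ℕ → Finset ℕ} {W : ℕ → ℕ}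
  {L e : ℕ}

/-- Insert `m` vertices, one after the other, into a triangle of a block. -/
theorem fill (m : ℕ) : ∀ {n : ℕ} {T : Finset (ℕ × ℕ × ℕ)} {B : ℕ → Finset ℕ} {e : ℕ},
    Frame k n T P B W L e → ∀ {u v x l : ℕ}, (u, v, x) ∈ T → u ∈ B l → v ∈ B l → x ∈ B l →
    (B l).card + m < k →
    ∃ T' B', Frame k (n + m) T' P B' W L (e + 3 * m) ∧ (∀ l', l' ≠ l → B' l' = B l') ∧
      (∀ t ∈ T, t ∉ rotations u v x → t ∈ T') ∧
      ∀ j, 0 < j → HasPath n T j u x →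
        ∃ x', HasPath (n + m) T' (j + m) u x' ∧ ∃ d, (x', u, d) ∈ T' := by
  induction m with
  | zero =>
    intro n T B e h u v x l hx _ _ _ _
    exact ⟨T, B, h, fun _ _ => rfl, fun t ht _ => ht,
      fun j _ hp => ⟨x, hp, v, h.tri.cyc (h.tri.cyc hx)⟩⟩
  | succ m ih =>
    intro n T B e h u v x l hx hu hv hxl hcard
    have hxP := (h.block _ _ hxl).2
    have h' := h.grow hx hu hv (.inr hxl) (by omega)
    rw [if_neg hxP] at h'
    have hn : (insert n (B l)).card = (B l).card + 1 :=
      Finset.card_insert_of_notMem (h.not_mem_block l)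
    -- The next vertex goes into the triangle of `u`, `v` and the vertex just inserted, so that the
    -- path always ends at a neighbor of `u`.
    obtain ⟨T', B', hF, hB', hT', hpath⟩ := ih h' (u := u) (v := v) (x := n) (l := l)
      (by simp [mem_stack]) (by simp [hu]) (by simp [hv]) (by simp)
      (by rw [Function.update_self, hn]; omega)
    refine ⟨T', B', ?_, ?_, ?_, ?_⟩
    · convert hF using 1 <;> ring
    · intro l' hl'
      rw [hB' l' hl', Function.update_of_ne hl']
    · intro t ht hr
      exact hT' t (mem_stack_of_mem ht hr) (h.tri.not_mem_rotations ht u v).1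
    · intro j hj hp
      obtain ⟨x', h1, h2⟩ := hpath (j + 1) (by omega) (hp.stack hj v)
      refine ⟨x', ?_, h2⟩
      convert h1 using 1 <;> ring

/-- Fill a block that is an edge next to a pole up to `k - 1` vertices. -/
theorem fillEdge {s : ℕ} (h : Frame (s + 4) n T P B W L e) {u v x l : ℕ} (hB : B l = {u, v})
    (hx : (u, v, x) ∈ T) (hxP : x ∈ P) :
    ∃ T' B', Frame (s + 4) (n + (s + 1)) T' P B' W L (e + (3 * s + 2)) ∧
      (∀ l', l' ≠ l → B' l' = B l') ∧ ∀ t ∈ T, t ∉ rotations u v x → t ∈ T' := by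
  have hu : u ∈ B l := by simp [hB]
  have hv : v ∈ B l := by simp [hB]
  have hc : (B l).card = 2 := by rw [hB, Finset.card_pair (h.tri.ne hx)]
  -- The first vertex lies next to the pole and brings two counted edges, the other `s` bring three
  -- each. With the edge `uv` itself this makes `3s + 3 = 3(k - 3)` for `k = s + 4`.
  have h' := h.grow hx hu hv (.inl hxP) (by omega)
  rw [if_pos hxP] at h'
  have hn : (insert n (B l)).card = (B l).card + 1 :=
    Finset.card_insert_of_notMem (h.not_mem_block l)
  obtain ⟨T', B', hF, hB', hT', -⟩ := h'.fill s (u := u) (v := v) (x := n) (l := l)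
    (by simp [mem_stack]) (by simp [hu]) (by simp [hv]) (by simp)
    (by rw [Function.update_self, hn]; omega)
  refine ⟨T', B', ?_, ?_, ?_⟩
  · convert hF using 1 <;> ring
  · intro l' hl'
    rw [hB' l' hl', Function.update_of_ne hl']
  · intro t ht hr
    exact hT' t (mem_stack_of_mem ht hr) (h.tri.not_mem_rotations ht u v).1

/-- Replace an edge of weight `w + 1` that has poles on both sides by a chain of `w + 1` blocks on
`k - 1` vertices. -/
theorem fillLeg {s : ℕ} (w : ℕ) : ∀ {n : ℕ} {T : Finset (ℕ × ℕ × ℕ)} {B : ℕ → Finset ℕ}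
    {W : ℕ → ℕ} {L e : ℕ}, Frame (s + 4) n T P B W L e → ∀ {u v x y l : ℕ}, B l = {u, v} →
    (u, v, x) ∈ T → (v, u, y) ∈ T → x ≠ y → x ∈ P → y ∈ P → W l = w + 1 →
    ∃ T' B' W' L', Frame (s + 4) (n + (w * (s + 2) + (s + 1))) T' P B' W' L'
        (e + (w * (3 * s + 3) + (3 * s + 2))) ∧ L ≤ L' ∧
      (∀ l' < L, l' ≠ l → B' l' = B l' ∧ W' l' = W l') ∧ W' l ≤ 1 ∧ (∀ l', L ≤ l' → W' l' ≤ 1) ∧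
      ∀ t ∈ T, t ∉ rotations u v x → t ∉ rotations v u y → t ∈ T' := by
  induction w with
  | zero =>
    intro n T B W L e h u v x y l hB hx _ _ hxP _ hW
    obtain ⟨T', B', hF, hB', hT'⟩ := h.fillEdge hB hx hxP
    refine ⟨T', B', W, L, ?_, le_rfl, fun l' _ hl' => ⟨hB' l' hl', rfl⟩, by omega,
      fun l' hl' => (h.unused l' hl').2, fun t ht hr _ => hT' t ht hr⟩
    simpa using hF
  | succ w ih =>
    intro n T B W L e h u v x y l hB hx hy hxy hxP hyP hW
    have huv := h.tri.ne hx
    have hvx := h.tri.ne (h.tri.cyc hx)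
    have hxu := h.tri.ne (h.tri.cyc (h.tri.cyc hx))
    have hyv := h.tri.ne (h.tri.cyc (h.tri.cyc hy))
    have hu := (h.tri.lt hx).ne
    have hv := (h.tri.lt₂ hx).ne
    have hxn := (h.tri.lt₃ hx).ne
    have hyn := (h.tri.lt₃ hy).ne
    have hlL : l < L := h.lt_of_mem (a := u) (by simp [hB])
    -- A piece of weight one is cut off and filled at once; the rest of the leg becomes the block
    -- `L`, again an edge between the same two poles, to which the induction applies.
    have h1 := h.split hB hx hy hxy hxP hyP (s := 1) (t := w + 1) (by omega)
    obtain ⟨T₁, B₁, hF₁, hB₁, hT₁⟩ := h1.fillEdge (u := u) (v := n) (x := x) (l := l)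
      (by simp [hlL.ne]) (by simp [mem_subdivide]) hxP
    obtain ⟨T₂, B₂, W₂, L₂, hF₂, hL, hkeep, hWL, hWge, hT₂⟩ := ih hF₁ (u := n) (v := v) (x := x)
      (y := y) (l := L) (by rw [hB₁ L hlL.ne']; simp)
      (hT₁ _ (by simp [mem_subdivide])
        (by simp only [mem_rotations, Prod.mk.injEq]; omega))
      (hT₁ _ (by simp [mem_subdivide])
        (by simp only [mem_rotations, Prod.mk.injEq]; omega))
      hxy hxP hyP (by simp)
    refine ⟨T₂, B₂, W₂, L₂, ?_, by omega, ?_, ?_, ?_, ?_⟩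
    · convert hF₂ using 1 <;> ring
    · intro l' hl' hne
      obtain ⟨h2, h3⟩ := hkeep l' (by omega) hl'.ne
      rw [h2, h3, hB₁ l' hne]
      simp [hl'.ne, hne]
    · rw [(hkeep l (by omega) hlL.ne).2]
      simp [hlL.ne]
    · intro l' hl'
      rcases hl'.eq_or_lt with rfl | hl'
      · exact hWL
      · exact hWge l' hl'
    · intro t ht hr hr'
      refine hT₂ t (hT₁ t (mem_subdivide_of_mem ht hr hr') (h.tri.not_mem_rotations ht _ _).2) ?_ ?_
      · have := (h.tri.not_mem_rotations ht v x).1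
        simp only [mem_rotations] at this ⊢
        tauto
      · exact (h.tri.not_mem_rotations ht _ _).2

/-- Fill `m` edges of weight `w + 1` that share an end. -/
theorem fillLegs {s : ℕ} (h : Frame (s + 4) n T P B W L e) (v w : ℕ) (u x y l : ℕ → ℕ) (m : ℕ)
    (hB : ∀ i < m, B (l i) = {u i, v}) (hx : ∀ i < m, (u i, v, x i) ∈ T)
    (hy : ∀ i < m, (v, u i, y i) ∈ T) (hxy : ∀ i < m, x i ≠ y i) (hxP : ∀ i < m, x i ∈ P)
    (hyP : ∀ i < m, y i ∈ P) (hW : ∀ i < m, W (l i) = w + 1)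
    (hl : ∀ i < m, ∀ j < m, l i = l j → i = j) (hu : ∀ i < m, ∀ j < m, u i = u j → i = j) :
    ∃ T' B' W' L', Frame (s + 4) (n + m * (w * (s + 2) + (s + 1))) T' P B' W' L'
        (e + m * (w * (3 * s + 3) + (3 * s + 2))) ∧ L ≤ L' ∧
      (∀ l' < L, (∀ i < m, l' ≠ l i) → B' l' = B l' ∧ W' l' = W l') ∧ (∀ i < m, W' (l i) ≤ 1) ∧
      (∀ l', L ≤ l' → W' l' ≤ 1) ∧
      ∀ t ∈ T, (∀ i < m, t ∉ rotations (u i) v (x i) ∧ t ∉ rotations v (u i) (y i)) → t ∈ T' := by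
  have huP : ∀ i < m, u i ∉ P := fun i hi => (h.block (l i) _ (by simp [hB i hi])).2
  have hvP : ∀ i < m, v ∉ P := fun i hi => (h.block (l i) _ (by simp [hB i hi])).2
  have huv : ∀ i < m, u i ≠ v := fun i hi => h.tri.ne (hx i hi)
  have hlL : ∀ i < m, l i < L := fun i hi => h.lt_of_mem (a := v) (by simp [hB i hi])
  have hne : ∀ p q, p ∈ P → q ∉ P → p ≠ q := fun p q hp hq hpq => hq (hpq ▸ hp)
  suffices H : ∀ m' ≤ m, ∃ T' B' W' L', Frame (s + 4) (n + m' * (w * (s + 2) + (s + 1))) T' P B' W'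
        L' (e + m' * (w * (3 * s + 3) + (3 * s + 2))) ∧ L ≤ L' ∧
      (∀ l' < L, (∀ i < m', l' ≠ l i) → B' l' = B l' ∧ W' l' = W l') ∧
      (∀ i < m', W' (l i) ≤ 1) ∧ (∀ l', L ≤ l' → W' l' ≤ 1) ∧
      ∀ t ∈ T, (∀ i < m', t ∉ rotations (u i) v (x i) ∧ t ∉ rotations v (u i) (y i)) → t ∈ T' from
    H m le_rfl
  intro m'
  induction m' with
  | zero =>
    intro _
    exact ⟨T, B, W, L, by simpa using h, le_rfl, fun _ _ _ => ⟨rfl, rfl⟩, by simp,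
      fun l' hl' => (h.unused l' hl').2, fun t ht _ => ht⟩
  | succ i ih =>
    intro hi
    obtain ⟨T₁, B₁, W₁, L₁, hF₁, hL₁, hkeep₁, hWl₁, hWge₁, hT₁⟩ := ih (by omega)
    have him : i < m := hi
    have hkeep := hkeep₁ (l i) (hlL i him) fun j hj hij => by
      have := hl i him j (by omega) hij
      omega
    have hxi : (u i, v, x i) ∈ T₁ := by
      refine hT₁ _ (hx i him) fun j hj => ?_
      have hjm : j < m := by omega
      have e1 : u i ≠ u j := fun hij => by have := hu i him j hjm hij; omega
      have e2 := huv i him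
      have e3 := hne _ _ (hxP j hjm) (huP i him)
      have e4 := hne _ _ (hyP j hjm) (huP i him)
      simp [mem_rotations, e1, e2, e3.symm, e4.symm]
    have hyi : (v, u i, y i) ∈ T₁ := by
      refine hT₁ _ (hy i him) fun j hj => ?_
      have hjm : j < m := by omega
      have e1 : u i ≠ u j := fun hij => by have := hu i him j hjm hij; omega
      have e2 := huv j hjm
      have e3 := hne _ _ (hxP j hjm) (huP i him)
      have e4 := hne _ _ (hyP j hjm) (hvP i him)
      simp [mem_rotations, e1, e2.symm, e3.symm, e4.symm]
    obtain ⟨T₂, B₂, W₂, L₂, hF₂, hL₂, hkeep₂, hWl₂, hWge₂, hT₂⟩ := hF₁.fillLeg w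
      (by rw [hkeep.1, hB i him]) hxi hyi (hxy i him) (hxP i him) (hyP i him)
      (by rw [hkeep.2, hW i him])
    refine ⟨T₂, B₂, W₂, L₂, ?_, by omega, ?_, ?_, ?_, ?_⟩
    · convert hF₂ using 1 <;> ring
    · intro l' hl' hne'
      obtain ⟨h1, h2⟩ := hkeep₂ l' (by omega) (hne' i (by omega))
      obtain ⟨h3, h4⟩ := hkeep₁ l' hl' fun j hj => hne' j (by omega)
      exact ⟨h1.trans h3, h2.trans h4⟩
    · intro j hj
      by_cases hji : j = i
      · rw [hji]; exact hWl₂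
      · have hjm : j < m := by omega
        have := hlL j hjm
        rw [(hkeep₂ (l j) (by omega) fun h1 => hji (hl j hjm i him h1)).2]
        exact hWl₁ j (by omega)
    · intro l' hl'
      by_cases hl₁ : l' < L₁
      · have := hlL i him
        rw [(hkeep₂ l' hl₁ (by omega)).2]
        exact hWge₁ l' hl'
      · exact hWge₂ l' (by omega)
    · intro t ht hr
      have := hr i (by omega)
      exact hT₂ t (hT₁ t ht fun j hj => hr j (by omega)) this.1 this.2

/-- Fill `m + 1` triangular blocks. If one of them lies on a path through three of its vertices and
another one, this creates a cycle of length `k`. -/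
theorem fillTriangles {s : ℕ} (h : Frame (s + 4) n T P B W L e) (u v x l : ℕ → ℕ) (m : ℕ)
    (hB : ∀ i ≤ m, B (l i) = {u i, v i, x i}) (hx : ∀ i ≤ m, (u i, v i, x i) ∈ T)
    (hl : ∀ i ≤ m, ∀ j ≤ m, l i = l j → i = j)
    (hr : ∀ i ≤ m, ∀ j ≤ m, i ≠ j → (u i, v i, x i) ∉ rotations (u j) (v j) (x j))
    {d d₁ d₂ : ℕ}
    (hd₁ : (u m, d, d₁) ∈ T) (hd₂ : (d, v m, d₂) ∈ T) (hdx : d ≠ x m)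
    (hd₁' : ∀ i < m, (u m, d, d₁) ∉ rotations (u i) (v i) (x i))
    (hd₂' : ∀ i < m, (d, v m, d₂) ∉ rotations (u i) (v i) (x i)) :
    ∃ T' B', Frame (s + 4) (n + (m + 1) * s) T' P B' W L (e + (m + 1) * (3 * s)) ∧
      ∃ a, HasPath (n + (m + 1) * s) T' (s + 4) (u m) a ∧ ∃ c, (a, u m, c) ∈ T' := by
  have hstep : ∀ m' ≤ m, ∃ T' B', Frame (s + 4) (n + m' * s) T' P B' W L (e + m' * (3 * s)) ∧
      (∀ l', (∀ i < m', l' ≠ l i) → B' l' = B l') ∧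
      ∀ t ∈ T, (∀ i < m', t ∉ rotations (u i) (v i) (x i)) → t ∈ T' := by
    intro m'
    induction m' with
    | zero =>
      intro _
      exact ⟨T, B, by simpa using h, fun _ _ => rfl, fun t ht _ => ht⟩
    | succ i ih =>
      intro hi
      obtain ⟨T₁, B₁, hF₁, hB₁, hT₁⟩ := ih (by omega)
      have hBi : B₁ (l i) = {u i, v i, x i} := by
        rw [hB₁ (l i) fun j hj hij => hj.ne' (hl i (by omega) j (by omega) hij), hB i (by omega)]
      have hxi := hT₁ _ (hx i (by omega)) fun j hj => hr i (by omega) j (by omega) (by omega)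
      have hcard : (B₁ (l i)).card ≤ 3 := hBi ▸ Finset.card_le_three
      obtain ⟨T₂, B₂, hF₂, hB₂, hT₂, -⟩ := hF₁.fill s hxi (l := l i) (by simp [hBi]) (by simp [hBi])
        (by simp [hBi]) (by omega)
      refine ⟨T₂, B₂, ?_, ?_, ?_⟩
      · convert hF₂ using 1 <;> ring
      · intro l' hl'
        rw [hB₂ l' (hl' i (by omega)), hB₁ l' fun j hj => hl' j (by omega)]
      · intro t ht htr
        exact hT₂ t (hT₁ t ht fun j hj => htr j (by omega)) (htr i (by omega))
  obtain ⟨T₁, B₁, hF₁, hB₁, hT₁⟩ := hstep m le_rfl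
  have hBi : B₁ (l m) = {u m, v m, x m} := by
    rw [hB₁ (l m) fun j hj hij => hj.ne' (hl m (by omega) j (by omega) hij), hB m (by omega)]
  have hxi := hT₁ _ (hx m (by omega)) fun j hj => hr m (by omega) j (by omega) (by omega)
  have hcard : (B₁ (l m)).card ≤ 3 := hBi ▸ Finset.card_le_three
  obtain ⟨T₂, B₂, hF₂, -, -, hpath⟩ := hF₁.fill s hxi (l := l m) (by simp [hBi]) (by simp [hBi])
    (by simp [hBi]) (by omega)
  have hd₁T := hT₁ _ hd₁ hd₁'
  have hd₂T := hT₁ _ hd₂ hd₂'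
  have huv := hF₁.tri.ne hxi
  have hvx := hF₁.tri.ne (hF₁.tri.cyc hxi)
  have hxu := hF₁.tri.ne (hF₁.tri.cyc (hF₁.tri.cyc hxi))
  have hud := hF₁.tri.ne hd₁T
  have hdv := hF₁.tri.ne hd₂T
  -- The path `u m, d, v m, x m` has four vertices, and the filling extends it by `s` to `s + 4 =
  -- k`. The detour through `d` is needed since the block itself ends up with only `k - 1` vertices.
  obtain ⟨a, ha, hc⟩ := hpath 4 (by omega)
    ⟨fun i => if i = 0 then u m else if i = 1 then d else if i = 2 then v m else x m, by simp,
      by simp, by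
        intro i hi j hj hij
        simp only [Set.mem_Iio] at hi hj
        interval_cases i <;> interval_cases j <;> simp at hij ⊢ <;> omega, by
        intro i hi
        have := hF₁.tri.lt hxi
        have := hF₁.tri.lt₂ hxi
        have := hF₁.tri.lt₃ hxi
        have := hF₁.tri.lt hd₂T
        interval_cases i <;> simpa, by
        intro i hi
        have : i < 3 := by omega
        interval_cases i
        exacts [⟨_, hd₁T⟩, ⟨_, hd₂T⟩, ⟨_, hF₁.tri.cyc hxi⟩]⟩
  have e1 : n + m * s + s = n + (m + 1) * s := by ring
  have e2 : e + m * (3 * s) + 3 * s = e + (m + 1) * (3 * s) := by ring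
  have e3 : 4 + s = s + 4 := by ring
  rw [e1, e2] at hF₂
  rw [e1, e3] at ha
  exact ⟨T₂, B₂, hF₂, a, ha, hc⟩

/-- Add `r` poles. -/
theorem addPoles (h : Frame k n T P B W L e) {j u x d : ℕ} (hp : HasPath n T j u x)
    (hd : (x, u, d) ∈ T) (r : ℕ) :
    ∃ T' P', P'.card = P.card + r ∧ Frame k (n + r) T' P' B W L e ∧ HasPath (n + r) T' j u x ∧
      ∃ d', (x, u, d') ∈ T' := by
  induction r with
  | zero => exact ⟨T, P, rfl, h, hp, d, hd⟩
  | succ r ih =>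
    obtain ⟨T', P', hc, hF, ⟨c, h0, h1, hinj, hlt, hadj⟩, d', hd'⟩ := ih
    refine ⟨_, _, ?_, hF.addPole hd', ⟨c, h0, h1, hinj, ?_, ?_⟩, IsTriangulation.adj_stack hd'⟩
    -- Each pole goes into the triangle along the closing dart from `x` to `u`, which survives every
    -- insertion.
    · rw [Finset.card_insert_of_notMem hF.not_mem_pole, hc, add_assoc]
    · exact fun i hi => (hlt i hi).trans (Nat.lt_succ_self _)
    · intro i hi
      obtain ⟨d, hd⟩ := hadj i hi
      exact IsTriangulation.adj_stack hd

end Frame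

end PlanarAntiRamsey

/-! ### The bipyramid and the spread of its units -/

namespace PlanarAntiRamsey

open Relation

theorem isTriangulation_triangle :
    IsTriangulation 3 (rotations 0 1 2 ∪ rotations 1 0 2) := by
  have key : ∀ t ∈ rotations 0 1 2 ∪ rotations 1 0 2,
      t.1 < 3 ∧ t.1 ≠ t.2.1 ∧ (t.2.1, t.2.2, t.1) ∈ rotations 0 1 2 ∪ rotations 1 0 2 ∧
      (t.2.1, t.1, t.2.2) ∈ rotations 0 1 2 ∪ rotations 1 0 2 ∧
      ∀ t' ∈ rotations 0 1 2 ∪ rotations 1 0 2, t.1 = t'.1 →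
        (t.2.1 = t'.2.1 → t.2.2 = t'.2.2) ∧
        (t.2.1 = t'.2.1 ∨ (t.1, t.2.1, t'.2.1) ∈ rotations 0 1 2 ∪ rotations 1 0 2) := by
    decide
  refine ⟨fun h => (key _ h).1, fun h => (key _ h).2.1, fun h => (key _ h).2.2.1,
    fun h h' => ((key _ h).2.2.2.2 _ h' rfl).1 rfl, fun h => ⟨_, (key _ h).2.2.2.1⟩, ?_, ?_, by decide⟩
  · intro v a b c d h h'
    rcases ((key _ h).2.2.2.2 _ h' rfl).2 with h1 | h1
    · dsimp only at h1
      rw [h1]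
    · exact .single h1
  · intro a b ha hb
    by_cases hab : a = b
    · rw [hab]
    · refine .single ?_
      have : ∀ a ∈ Finset.range 3, ∀ b ∈ Finset.range 3, a ≠ b →
          ∃ c ∈ Finset.range 3, (a, b, c) ∈ rotations 0 1 2 ∪ rotations 1 0 2 := by decide
      obtain ⟨c, -, hc⟩ := this a (Finset.mem_range.2 ha) b (Finset.mem_range.2 hb) hab
      exact ⟨c, hc⟩

/-- The bipyramid with apices `0` and `1` over the cycle `2, 3, …, m + 4`. -/
theorem exists_bipyramid (m : ℕ) : ∃ T, IsTriangulation (m + 5) T ∧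
    (∀ a, 2 ≤ a → a < m + 4 → (a, a + 1, 0) ∈ T ∧ (a + 1, a, 1) ∈ T) ∧
    (m + 4, 2, 0) ∈ T ∧ (2, m + 4, 1) ∈ T ∧
    (∀ a b c, (a, b, c) ∈ T → a < b →
      (a ≤ 1 ∧ 2 ≤ b) ∨ (2 ≤ a ∧ b = a + 1) ∨ (a = 2 ∧ b = m + 4)) ∧
    ∀ g : ℕ × ℕ × ℕ → ℕ, (∀ a b c d, g (a, b, c) = g (a, b, d)) →
      ∑ t ∈ T, g t =
        ∑ i ∈ Finset.range (m + 3), (g (i + 2, 0, 0) + g (0, i + 2, 0) + g (i + 2, 1, 0) +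
          g (1, i + 2, 0)) +
        ∑ i ∈ Finset.range (m + 2), (g (i + 2, i + 3, 0) + g (i + 3, i + 2, 0)) +
        (g (2, m + 4, 0) + g (m + 4, 2, 0)) := by
  induction m with
  | zero =>
    -- The two-faced triangle `0, 1, 2` becomes `K₄` by adding `3`. Subdividing the edge `01` by `4`
    -- then separates the apices and closes the rim `2, 3, 4`.
    have h3 := isTriangulation_triangle
    have h4 := h3.stack (u := 1) (v := 0) (x := 2) (by decide)
    have h5 := h4.subdivide (u := 0) (v := 1) (x := 2) (y := 3) (by decide) (by decide) (by decide)
    refine ⟨_, h5, ?_, by decide, by decide, ?_, ?_⟩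
    · intro a h1 h2
      have : a = 2 ∨ a = 3 := by omega
      rcases this with rfl | rfl <;> decide
    · intro a b c ht hab
      have : ∀ t ∈ subdivide (stack (rotations 0 1 2 ∪ rotations 1 0 2) 1 0 2 3) 0 1 2 3 4,
          t.1 < t.2.1 → (t.1 ≤ 1 ∧ 2 ≤ t.2.1) ∨ (2 ≤ t.1 ∧ t.2.1 = t.1 + 1) ∨
            (t.1 = 2 ∧ t.2.1 = 4) := by decide
      exact this _ ht hab
    · intro g hg
      have e4 := h3.sum_stack (u := 1) (v := 0) (x := 2) (by decide) g hg
      have e5 := h4.sum_subdivide (u := 0) (v := 1) (x := 2) (y := 3) (by decide) (by decide)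
        g hg
      rw [e4, Finset.sum_union (by decide), sum_rotations (by decide),
        sum_rotations (by decide), hg 0 1 2 0, hg 1 2 0 0, hg 2 0 1 0,
        hg 1 0 2 0, hg 0 2 1 0, hg 2 1 0 0] at e5
      simp only [Finset.sum_range_succ, Finset.sum_range_zero]
      norm_num at e5 ⊢
      omega
  | succ m ih =>
    obtain ⟨T, hT, hrim, h0, h1, hadj, hsum⟩ := ih
    -- The new rim vertex `m + 5` goes on the closing rim edge between `m + 4` and `2`.
    have hS := hT.subdivide h0 h1 (by decide)
    refine ⟨_, hS, ?_, by simp [mem_subdivide], by simp [mem_subdivide], ?_, ?_⟩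
    · intro a h2 h3
      by_cases ha : a = m + 4
      · subst ha
        simp [mem_subdivide]
      · obtain ⟨h4, h5⟩ := hrim a h2 (by omega)
        constructor
        · refine mem_subdivide_of_mem h4 ?_ ?_ <;>
            simp only [mem_rotations, Prod.mk.injEq] <;> omega
        · refine mem_subdivide_of_mem h5 ?_ ?_ <;>
            simp only [mem_rotations, Prod.mk.injEq] <;> omega
    · intro a b c ht hab
      rcases mem_subdivide.1 ht with ⟨h2, h3⟩ | h2
      · rcases hadj a b c h2 hab with h4 | h4 | ⟨rfl, rfl⟩
        · exact .inl h4
        · exact .inr (.inl h4)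
        · simp [hT.unique h2 h1] at h3
      · simp only [Prod.mk.injEq] at h2
        omega
    · intro g hg
      have e := hT.sum_subdivide h0 h1 g hg
      rw [hsum g hg] at e
      rw [Finset.sum_range_succ _ (m + 2), Finset.sum_range_succ _ (m + 3)]
      simp only [add_assoc, Nat.reduceAdd] at e ⊢
      omega

/-- The blocks of the frame with `q` units: the triangle `0, 3i + 2, 3i + 3` and the edges from
its last two corners to `1`. -/
def unitBlock (q l : ℕ) : Finset ℕ :=
  if l < 3 * q then if l % 3 = 0 then {0, l + 2, l + 3} else {l + 1, 1} else ∅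

/-- The weights of the blocks `unitBlock q`. -/
def unitWeight (q a b l : ℕ) : ℕ :=
  if l < 3 * q then if l % 3 = 0 then 1 else if l % 3 = 1 then a else b else 1

/-- A potential that is constant but for the apices and one unit. -/
def unitPotential (i : ℕ) (ν α β δ : ℤ) (z : ℕ) : ℤ :=
  if z = 1 then 0 else if z = 0 then ν else if z = 3 * i + 2 then α else
    if z = 3 * i + 3 then β else δ

theorem mem_unitBlock {q l z : ℕ} : z ∈ unitBlock q l ↔ l < 3 * q ∧
    ((l % 3 = 0 ∧ (z = 0 ∨ z = l + 2 ∨ z = l + 3)) ∨ (l % 3 ≠ 0 ∧ (z = l + 1 ∨ z = 1))) := by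
  unfold unitBlock
  split_ifs <;> simp [*]

/-- All units but the `i`-th see only the values `ν`, `δ` and `0`, so the bounds on `δ` and `ν - δ`
settle them at once. The conditions on unit `i` are waived for the block `l` that is left out. -/
theorem unitPotential_le {q a b i l : ℕ} {ν α β δ : ℤ} (hδ : -b ≤ δ ∧ δ ≤ b) (hab : b ≤ a)
    (hν : -1 ≤ ν - δ ∧ ν - δ ≤ 1)
    (hT : l ≠ 3 * i → -1 ≤ ν - α ∧ ν - α ≤ 1 ∧ -1 ≤ ν - β ∧ ν - β ≤ 1 ∧ -1 ≤ α - β ∧ α - β ≤ 1)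
    (hA : l ≠ 3 * i + 1 → -a ≤ α ∧ α ≤ a) (hB : l ≠ 3 * i + 2 → -b ≤ β ∧ β ≤ b) :
    ∀ m, m ≠ l → ∀ x ∈ unitBlock q m, ∀ y ∈ unitBlock q m,
      unitPotential i ν α β δ x ≤ unitPotential i ν α β δ y + unitWeight q a b m := by
  intro m hm x hx y hy
  rw [mem_unitBlock] at hx hy
  obtain ⟨hmq, hx⟩ := hx
  obtain ⟨-, hy⟩ := hy
  have h3 : m % 3 = 0 ∨ m % 3 = 1 ∨ m % 3 = 2 := by omega
  obtain ⟨j, hj⟩ : ∃ j, j = m / 3 := ⟨_, rfl⟩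
  rcases h3 with h3 | h3 | h3
  · obtain rfl : m = 3 * j := by omega
    simp only [unitWeight, hmq, h3, if_true]
    have hx : x = 0 ∨ x = 3 * j + 2 ∨ x = 3 * j + 3 := by omega
    have hy : y = 0 ∨ y = 3 * j + 2 ∨ y = 3 * j + 3 := by omega
    by_cases hji : j = i
    · subst hji
      have := hT (by omega)
      rcases hx with rfl | rfl | rfl <;> rcases hy with rfl | rfl | rfl <;>
        simp [unitPotential] <;> omega
    · have n1 : 3 * j + 3 ≠ 3 * i + 2 := by omega
      have n2 : 3 * j + 2 ≠ 3 * i + 3 := by omega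
      rcases hx with rfl | rfl | rfl <;> rcases hy with rfl | rfl | rfl <;>
        simp [unitPotential, hji] <;> omega
  · obtain rfl : m = 3 * j + 1 := by omega
    simp only [unitWeight, hmq, h3, if_true, one_ne_zero, if_false]
    have hx : x = 1 ∨ x = 3 * j + 2 := by omega
    have hy : y = 1 ∨ y = 3 * j + 2 := by omega
    have n2 : 3 * j + 2 ≠ 3 * i + 3 := by omega
    by_cases hji : j = i
    · subst hji
      have := hA (by omega)
      rcases hx with rfl | rfl <;> rcases hy with rfl | rfl <;>
        simp [unitPotential] <;> omega
    · rcases hx with rfl | rfl <;> rcases hy with rfl | rfl <;>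
        simp [unitPotential, hji] <;> omega
  · obtain rfl : m = 3 * j + 2 := by omega
    simp only [unitWeight, hmq, h3, if_true, OfNat.ofNat_ne_zero, OfNat.ofNat_ne_one, if_false]
    have hx : x = 1 ∨ x = 3 * j + 3 := by omega
    have hy : y = 1 ∨ y = 3 * j + 3 := by omega
    have n1 : 3 * j + 3 ≠ 3 * i + 2 := by omega
    by_cases hji : j = i
    · subst hji
      have := hB (by omega)
      rcases hx with rfl | rfl <;> rcases hy with rfl | rfl <;>
        simp [unitPotential] <;> omega
    · rcases hx with rfl | rfl <;> rcases hy with rfl | rfl <;>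
        simp [unitPotential, hji] <;> omega

/-- The blocks of one unit form a ring of weight `1 + a + b = k + 1`, so leaving out one of them
leaves a detour of just the required length. A detour through another unit costs at least `b + 1`
between the apices; for example, from `0` to `3i + 3` it has length `2b + 1 ≥ k`, which is where `a
≤ b + 1` enters. The potentials are signed distances from the apex `1`, set to `0` off the detour.
-/
theorem spread_unitBlock (q : ℕ) {k a b : ℕ} (hk : a + b = k) (hab : b ≤ a) (hba : a ≤ b + 1) :
    Spread k (unitBlock q) (unitWeight q a b) := by
  intro l u hu v hv huv
  rw [mem_unitBlock] at hu hv
  obtain ⟨hlq, hu⟩ := hu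
  obtain ⟨-, hv⟩ := hv
  have h3 : l % 3 = 0 ∨ l % 3 = 1 ∨ l % 3 = 2 := by omega
  obtain ⟨i, hi⟩ : ∃ i, i = l / 3 := ⟨_, rfl⟩
  have hself : ∀ ν α β δ : ℤ, unitPotential i ν α β δ 0 = ν ∧ unitPotential i ν α β δ 1 = 0 ∧
      unitPotential i ν α β δ (3 * i + 2) = α ∧ unitPotential i ν α β δ (3 * i + 3) = β := by
    intro ν α β δ
    simp [unitPotential]
  rcases h3 with h3 | h3 | h3
  · obtain rfl : l = 3 * i := by omega
    simp only [unitWeight, hlq, h3, if_true]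
    have hu : u = 0 ∨ u = 3 * i + 2 ∨ u = 3 * i + 3 := by omega
    have hv : v = 0 ∨ v = 3 * i + 2 ∨ v = 3 * i + 3 := by omega
    rcases hu with rfl | rfl | rfl <;> rcases hv with rfl | rfl | rfl
    · exact absurd rfl huv
    · have hs := hself (b + 1) (-a) 0 b
      exact ⟨unitPotential i (b + 1) (-a) 0 b, unitPotential_le (by omega) hab (by omega) (by omega)
        (by omega) (by omega), by omega⟩
    · have hs := hself (b + 1) 0 (-b) b
      exact ⟨unitPotential i (b + 1) 0 (-b) b, unitPotential_le (by omega) hab (by omega) (by omega)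
        (by omega) (by omega), by omega⟩
    · have hs := hself (-(b + 1)) a 0 (-b)
      exact ⟨unitPotential i (-(b + 1)) a 0 (-b), unitPotential_le (by omega) hab (by omega)
        (by omega) (by omega) (by omega), by omega⟩
    · exact absurd rfl huv
    · have hs := hself 0 a (-b) 0
      exact ⟨unitPotential i 0 a (-b) 0, unitPotential_le (by omega) hab (by omega)
        (by omega) (by omega) (by omega), by omega⟩
    · have hs := hself (-(b + 1)) 0 b (-b)
      exact ⟨unitPotential i (-(b + 1)) 0 b (-b), unitPotential_le (by omega) hab (by omega)
        (by omega) (by omega) (by omega), by omega⟩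
    · have hs := hself 0 (-a) b 0
      exact ⟨unitPotential i 0 (-a) b 0, unitPotential_le (by omega) hab (by omega)
        (by omega) (by omega) (by omega), by omega⟩
    · exact absurd rfl huv
  · obtain rfl : l = 3 * i + 1 := by omega
    simp only [unitWeight, hlq, h3, if_true, one_ne_zero, if_false]
    have hu : u = 1 ∨ u = 3 * i + 2 := by omega
    have hv : v = 1 ∨ v = 3 * i + 2 := by omega
    rcases hu with rfl | rfl <;> rcases hv with rfl | rfl
    · exact absurd rfl huv
    · have hs := hself (-(b + 1)) (-(b + 1)) (-b) (-b)
      exact ⟨unitPotential i (-(b + 1)) (-(b + 1)) (-b) (-b), unitPotential_le (by omega) hab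
        (by omega) (by omega) (by omega) (by omega), by omega⟩
    · have hs := hself (b + 1) (b + 1) b b
      exact ⟨unitPotential i (b + 1) (b + 1) b b, unitPotential_le (by omega) hab
        (by omega) (by omega) (by omega) (by omega), by omega⟩
    · exact absurd rfl huv
  · obtain rfl : l = 3 * i + 2 := by omega
    simp only [unitWeight, hlq, h3, if_true, OfNat.ofNat_ne_zero, OfNat.ofNat_ne_one, if_false]
    have hu : u = 1 ∨ u = 3 * i + 3 := by omega
    have hv : v = 1 ∨ v = 3 * i + 3 := by omega
    rcases hu with rfl | rfl <;> rcases hv with rfl | rfl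
    · exact absurd rfl huv
    · have hs := hself (-(b + 1)) (-a) (-(a + 1)) (-b)
      exact ⟨unitPotential i (-(b + 1)) (-a) (-(a + 1)) (-b), unitPotential_le (by omega) hab
        (by omega) (by omega) (by omega) (by omega), by omega⟩
    · have hs := hself (b + 1) a (a + 1) b
      exact ⟨unitPotential i (b + 1) a (a + 1) b, unitPotential_le (by omega) hab
        (by omega) (by omega) (by omega) (by omega), by omega⟩
    · exact absurd rfl huv

end PlanarAntiRamsey

/-! ### Assembling the frame from the units -/

namespace PlanarAntiRamsey

/-- The summand belongs to the rim vertex `i + 2`: a non-pole has two edges to the apices, and the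
first vertex of a unit also accounts for the rim edge to the second. -/
theorem sum_unit_edges (q : ℕ) :
    ∑ i ∈ Finset.range (3 * q), (if i % 3 = 0 then 3 else if i % 3 = 1 then 2 else 0) = 5 * q := by
  induction q with
  | zero => simp
  | succ q ih =>
    rw [show 3 * (q + 1) = 3 * q + 1 + 1 + 1 by ring, Finset.sum_range_succ,
      Finset.sum_range_succ, Finset.sum_range_succ, ih]
    have h0 : 3 * q % 3 = 0 := by omega
    have h1 : (3 * q + 1) % 3 = 1 := by omega
    have h2 : (3 * q + 1 + 1) % 3 = 2 := by omega
    simp only [h0, h1, h2]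
    norm_num
    ring

/-- The poles between the units: every third vertex of the rim of the bipyramid. -/
def rimPoles (q : ℕ) : Finset ℕ := (Finset.range q).image fun i => 3 * i + 4

theorem mem_rimPoles {q z : ℕ} : z ∈ rimPoles q ↔ 4 ≤ z ∧ z < 3 * q + 2 ∧ z % 3 = 1 := by
  simp only [rimPoles, Finset.mem_image, Finset.mem_range]
  constructor
  · rintro ⟨i, hi, rfl⟩
    omega
  · rintro ⟨h1, h2, h3⟩
    exact ⟨z / 3 - 1, by omega, by omega⟩

theorem card_rimPoles (q : ℕ) : (rimPoles q).card = q := by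
  rw [rimPoles, Finset.card_image_of_injective _ (fun i j h => by simpa using h), Finset.card_range]

/-- The rim vertex before the vertex `3i + 2` of the rim `2, …, 3m + 4`. -/
def rimPred (m i : ℕ) : ℕ := if i = 0 then 3 * m + 4 else 3 * i + 1

theorem rimPred_spec {m i : ℕ} (hi : i ≤ m) :
    4 ≤ rimPred m i ∧ rimPred m i < 3 * m + 5 ∧ rimPred m i % 3 = 1 := by
  unfold rimPred
  split_ifs <;> omega

/-- The bipyramid as a frame with `m + 1` units. -/
theorem exists_frame_bipyramid (m : ℕ) {k a b : ℕ} (hk : a + b = k) (hk3 : 3 < k) (hab : b ≤ a)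
    (hba : a ≤ b + 1) :
    ∃ T, Frame k (3 * m + 5) T (rimPoles (m + 1)) (unitBlock (m + 1)) (unitWeight (m + 1) a b)
        (3 * (m + 1)) (5 * (m + 1)) ∧
      ∀ i ≤ m, (3 * i + 3, 3 * i + 2, 1) ∈ T ∧ (0, 3 * i + 2, 3 * i + 3) ∈ T ∧
        (1, 3 * i + 2, rimPred m i) ∈ T ∧ (0, rimPred m i, 3 * i + 2) ∈ T ∧
        (3 * i + 3, 1, 3 * i + 4) ∈ T := by
  obtain ⟨T, hT, hrim, h0, h1, hadj, hsum⟩ := exists_bipyramid (3 * m)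
  refine ⟨T, ⟨hT, ?_, ?_, ?_, spread_unitBlock (m + 1) hk hab hba, ?_, ?_, ?_⟩, ?_⟩
  · intro p hp
    rw [mem_rimPoles] at hp
    refine ⟨by omega, ?_⟩
    obtain ⟨h2, h3⟩ := hrim (p - 1) (by omega) (by omega)
    rw [Nat.sub_add_cancel (by omega)] at h2
    refine ⟨0, p - 1, hT.cyc h2, .inl ?_⟩
    rw [mem_rimPoles]
    omega
  · intro l z hz
    rw [mem_unitBlock] at hz
    rw [mem_rimPoles]
    omega
  · have key : ∀ p q r, (p, q, r) ∈ T → p ∉ rimPoles (m + 1) → q ∉ rimPoles (m + 1) → p < q →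
        ∃ l, p ∈ unitBlock (m + 1) l ∧ q ∈ unitBlock (m + 1) l := by
      intro p q r ht hp hq hpq
      have hadj := hadj p q r ht hpq
      have hpn := hT.lt ht
      have hqn := hT.lt₂ ht
      rw [mem_rimPoles] at hp hq
      simp only [mem_unitBlock]
      have h5 : p = 0 ∨ p = 1 ∨ 2 ≤ p := by omega
      rcases h5 with h5 | h5 | h5
      -- An edge at `0` lies in the triangle of its unit; an edge from `1` to `q` is the leg with
      -- index `q - 1`; a pole-free rim edge from `p` lies in the triangle with index `p - 2`.
      · exact ⟨3 * ((q - 2) / 3), by omega⟩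
      · exact ⟨q - 1, by omega⟩
      · exact ⟨p - 2, by omega⟩
    intro p q r ht hp hq
    rcases (hT.ne ht).lt_or_gt with h2 | h2
    · exact key p q r ht hp hq h2
    · obtain ⟨d, hd⟩ := hT.symm ht
      obtain ⟨l, h3, h4⟩ := key q p d hd hq hp h2
      exact ⟨l, h4, h3⟩
  · intro l
    unfold unitBlock
    split_ifs
    · exact Finset.card_le_three.trans_lt hk3
    · exact Finset.card_le_two.trans_lt (by omega)
    · simp; omega
  · intro l hl
    simp [unitBlock, unitWeight, hl.not_gt]
  · rw [hsum (edgeWeight (rimPoles (m + 1))) (fun _ _ _ _ => rfl), ← sum_unit_edges (m + 1),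
      show 3 * (m + 1) = 3 * m + 2 + 1 by ring, Finset.sum_range_succ _ (3 * m + 2),
      Finset.sum_range_succ (fun i => if i % 3 = 0 then 3 else if i % 3 = 1 then 2 else 0)]
    -- The last rim vertex is a pole, so neither its edges nor the closing rim edge count.
    have hlast : 3 * m + 4 ∈ rimPoles (m + 1) := mem_rimPoles.2 (by omega)
    have hmod : (3 * m + 2) % 3 = 2 := by omega
    have h00 : 0 ∉ rimPoles (m + 1) := by simp [mem_rimPoles]
    have h01 : 1 ∉ rimPoles (m + 1) := by simp [mem_rimPoles]
    simp only [edgeWeight, hlast, hmod]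
    simp only [not_true, and_false, false_and, if_false, add_zero, not_lt_zero]
    rw [← Finset.sum_add_distrib]
    refine Finset.sum_congr rfl fun i hi => ?_
    rw [Finset.mem_range] at hi
    have e1 : i + 2 ∈ rimPoles (m + 1) ↔ i % 3 = 2 := by rw [mem_rimPoles]; omega
    have e2 : i + 3 ∈ rimPoles (m + 1) ↔ i % 3 = 1 := by rw [mem_rimPoles]; omega
    have h3 : i % 3 = 0 ∨ i % 3 = 1 ∨ i % 3 = 2 := by omega
    rcases h3 with h3 | h3 | h3 <;> simp [e1, e2, h3, h00, h01]
  · intro i hi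
    obtain ⟨h2, h3⟩ := hrim (3 * i + 2) (by omega) (by omega)
    obtain ⟨h4, h5⟩ := hrim (3 * i + 3) (by omega) (by omega)
    refine ⟨h3, hT.cyc (hT.cyc h2), ?_, ?_, hT.cyc h5⟩
    · unfold rimPred
      split_ifs with h6
      · subst h6
        exact hT.cyc (hT.cyc h1)
      · have := (hrim (3 * i + 1) (by omega) (by omega)).2
        exact hT.cyc (hT.cyc this)
    · unfold rimPred
      split_ifs with h6
      · subst h6
        exact hT.cyc (hT.cyc h0)
      · have := (hrim (3 * i + 1) (by omega) (by omega)).1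
        exact hT.cyc (hT.cyc this)

/-- The frame with `m + 1` units, before the blocks are filled: every unit has a pole of its own
next to the edge that joins its two rim vertices. -/
theorem exists_frame_units (m : ℕ) {k a b : ℕ} (hk : a + b = k) (hk3 : 3 < k) (hab : b ≤ a)
    (hba : a ≤ b + 1) :
    ∃ T P, P.card = 2 * (m + 1) ∧
      Frame k (4 * m + 6) T P (unitBlock (m + 1)) (unitWeight (m + 1) a b)
        (3 * (m + 1)) (5 * (m + 1)) ∧
      ∀ i ≤ m, (0, 3 * i + 2, 3 * i + 3) ∈ T ∧ (0, rimPred m i, 3 * i + 2) ∈ T ∧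
        (3 * i + 2, 1, 3 * m + 5 + i) ∈ T ∧ (1, 3 * i + 2, rimPred m i) ∈ T ∧
        (3 * i + 3, 1, 3 * i + 4) ∈ T ∧ (1, 3 * i + 3, 3 * m + 5 + i) ∈ T ∧
        3 * m + 5 + i ∈ P ∧ rimPred m i ∈ P ∧ 3 * i + 4 ∈ P := by
  obtain ⟨T, hT, hfaces⟩ := exists_frame_bipyramid m hk hk3 hab hba
  have hstep : ∀ j ≤ m + 1, ∃ T' P', P'.card = m + 1 + j ∧
      Frame k (3 * m + 5 + j) T' P' (unitBlock (m + 1)) (unitWeight (m + 1) a b)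
        (3 * (m + 1)) (5 * (m + 1)) ∧ rimPoles (m + 1) ⊆ P' ∧
      (∀ t ∈ T, (∀ i < j, t ∉ rotations (3 * i + 3) (3 * i + 2) 1) → t ∈ T') ∧
      ∀ i < j, (3 * i + 2, 1, 3 * m + 5 + i) ∈ T' ∧ (1, 3 * i + 3, 3 * m + 5 + i) ∈ T' ∧
        3 * m + 5 + i ∈ P' := by
    intro j
    induction j with
    | zero =>
      intro _
      exact ⟨T, _, card_rimPoles _, hT, subset_rfl, fun t ht _ => ht, by simp⟩
    | succ j ih =>
      intro hj
      obtain ⟨T', P', hc, hF, hP, hkeep, hnew⟩ := ih (by omega)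
      have hface : (3 * j + 3, 3 * j + 2, 1) ∈ T' := by
        refine hkeep _ (hfaces j (by omega)).1 fun i hi => ?_
        simp only [mem_rotations, Prod.mk.injEq]
        omega
      refine ⟨_, _, ?_, hF.addPole hface, ?_, ?_, ?_⟩
      · rw [Finset.card_insert_of_notMem hF.not_mem_pole, hc, add_assoc]
      · exact hP.trans (Finset.subset_insert _ _)
      · intro t ht hr
        exact mem_stack_of_mem (hkeep t ht fun i hi => hr i (by omega)) (hr j (by omega))
      · intro i hi
        by_cases hij : i = j
        · subst hij
          simp [mem_stack]
        · obtain ⟨h1, h2, h3⟩ := hnew i (by omega)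
          refine ⟨mem_stack_of_mem h1 ?_, mem_stack_of_mem h2 ?_, Finset.mem_insert_of_mem h3⟩ <;>
            simp only [mem_rotations, Prod.mk.injEq] <;> omega
  obtain ⟨T', P', hc, hF, hP, hkeep, hnew⟩ := hstep (m + 1) le_rfl
  refine ⟨T', P', by omega, by convert hF using 1; ring, ?_⟩
  intro i hi
  obtain ⟨-, h2, h3, h4, h5⟩ := hfaces i hi
  obtain ⟨h6, h7, h8⟩ := hnew i (by omega)
  have hpred := rimPred_spec hi
  refine ⟨hkeep _ h2 ?_, hkeep _ h4 ?_, h6, hkeep _ h3 ?_, hkeep _ h5 ?_, h7, h8,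
    hP (mem_rimPoles.2 (by omega)), hP (mem_rimPoles.2 (by omega))⟩ <;>
  · intro j hj
    simp only [mem_rotations, Prod.mk.injEq]
    omega

/-- A frame with `m + 1` units all of whose blocks have weight one, and which contains a cycle of
length `k = s + 4`. -/
theorem exists_frame (s m r : ℕ) :
    ∃ T P B W L, P.card = 2 * (m + 1) + r ∧ Frame (s + 4) ((m + 1) * (s ^ 2 + 7 * s + 10) + 2 + r)
        T P B W L ((m + 1) * (3 * s ^ 2 + 18 * s + 15)) ∧ (∀ l, W l ≤ 1) ∧
      ∃ u a, HasPath ((m + 1) * (s ^ 2 + 7 * s + 10) + 2 + r) T (s + 4) u a ∧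
        ∃ c, (a, u, c) ∈ T := by
  -- The leg weights `w + 1` and `w' + 1` are the two halves of `k = s + 4`, rounded up and down.
  obtain ⟨w, w', hw, hw1, hw2⟩ : ∃ w w', w + w' = s + 2 ∧ w' ≤ w ∧ w ≤ w' + 1 :=
    ⟨s + 2 - (s + 2) / 2, (s + 2) / 2, by omega, by omega, by omega⟩
  obtain ⟨T, P, hP, hF, hfaces⟩ := exists_frame_units m (k := s + 4) (a := w + 1) (b := w' + 1)
    (by omega) (by omega) (by omega) (by omega)
  have hpred : ∀ i ≤ m, _ := fun i hi => rimPred_spec hi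
  obtain ⟨T₁, B₁, W₁, L₁, hF₁, hL₁, hkeep₁, hWl₁, hWge₁, hT₁⟩ := hF.fillLegs 1 w
    (fun i => 3 * i + 2) (fun i => 3 * m + 5 + i) (rimPred m) (fun i => 3 * i + 1) (m + 1)
    (fun i hi => by
      have h1 : 3 * i + 1 < 3 * (m + 1) := by omega
      have h2 : (3 * i + 1) % 3 = 1 := by omega
      simp [unitBlock, h1, h2])
    (fun i hi => (hfaces i (by omega)).2.2.1) (fun i hi => (hfaces i (by omega)).2.2.2.1)
    (fun i hi => by have := hpred i (by omega); omega)
    (fun i hi => (hfaces i (by omega)).2.2.2.2.2.2.1)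
    (fun i hi => (hfaces i (by omega)).2.2.2.2.2.2.2.1)
    (fun i hi => by
      have h1 : 3 * i + 1 < 3 * (m + 1) := by omega
      have h2 : (3 * i + 1) % 3 = 1 := by omega
      simp [unitWeight, h1, h2])
    (fun i _ j _ hij => by omega) (fun i _ j _ hij => by omega)
  obtain ⟨T₂, B₂, W₂, L₂, hF₂, hL₂, hkeep₂, hWl₂, hWge₂, hT₂⟩ := hF₁.fillLegs 1 w'
    (fun i => 3 * i + 3) (fun i => 3 * i + 4) (fun i => 3 * m + 5 + i) (fun i => 3 * i + 2) (m + 1)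
    (fun i hi => by
      have h1 : 3 * i + 2 < 3 * (m + 1) := by omega
      have h2 : (3 * i + 2) % 3 = 2 := by omega
      rw [(hkeep₁ (3 * i + 2) (by omega) (fun j _ => by omega)).1]
      simp [unitBlock, h1, h2])
    (fun i hi => by
      refine hT₁ _ (hfaces i (by omega)).2.2.2.2.1 fun j hj => ?_
      have := hpred j (by omega)
      simp only [mem_rotations, Prod.mk.injEq]
      omega)
    (fun i hi => by
      refine hT₁ _ (hfaces i (by omega)).2.2.2.2.2.1 fun j hj => ?_
      have := hpred j (by omega)
      simp only [mem_rotations, Prod.mk.injEq]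
      omega)
    (fun i hi => by omega)
    (fun i hi => (hfaces i (by omega)).2.2.2.2.2.2.2.2)
    (fun i hi => (hfaces i (by omega)).2.2.2.2.2.2.1)
    (fun i hi => by
      have h1 : 3 * i + 2 < 3 * (m + 1) := by omega
      have h2 : (3 * i + 2) % 3 = 2 := by omega
      rw [(hkeep₁ (3 * i + 2) (by omega) (fun j _ => by omega)).2]
      simp [unitWeight, h1, h2])
    (fun i _ j _ hij => by omega) (fun i _ j _ hij => by omega)
  -- Filling the legs gives up only such triangles of `T` as contain the apex `1`.
  have hkeep : ∀ a b c, (a, b, c) ∈ T → a ≠ 1 → b ≠ 1 → c ≠ 1 → (a, b, c) ∈ T₂ := by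
    intro a b c ht ha hb hc
    refine hT₂ _ (hT₁ _ ht fun j _ => ?_) fun j _ => ?_ <;>
    · simp only [mem_rotations, Prod.mk.injEq]
      omega
  have hface : ∀ i ≤ m, (0, 3 * i + 2, 3 * i + 3) ∈ T₂ := fun i hi =>
    hkeep _ _ _ (hfaces i hi).1 (by omega) (by omega) (by omega)
  have hprem := hpred m le_rfl
  -- The rim pole before the last unit is the vertex outside the block that the cycle of length `k`
  -- passes through.
  have hpm : (0, rimPred m m, 3 * m + 2) ∈ T₂ :=
    hkeep _ _ _ (hfaces m le_rfl).2.1 (by omega) (by omega) (by omega)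
  obtain ⟨T₃, B₃, hF₃, a, ha, c, hc⟩ := hF₂.fillTriangles (fun _ => 0) (fun i => 3 * i + 2)
    (fun i => 3 * i + 3) (fun i => 3 * i) m
    (fun i hi => by
      have h1 : 3 * i < 3 * (m + 1) := by omega
      rw [(hkeep₂ (3 * i) (by omega) (fun j _ => by omega)).1,
        (hkeep₁ (3 * i) (by omega) (fun j _ => by omega)).1]
      simp [unitBlock, h1])
    hface (fun i _ j _ hij => by omega)
    (fun i _ j _ hij => by
      simp only [mem_rotations, Prod.mk.injEq]
      omega)
    hpm (hF₂.tri.cyc hpm) (by omega)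
    (fun i _ => by
      simp only [mem_rotations, Prod.mk.injEq]
      omega)
    (fun i _ => by
      simp only [mem_rotations, Prod.mk.injEq]
      omega)
  obtain ⟨T₄, P₄, hP₄, hF₄, hpath, hcyc⟩ := hF₃.addPoles ha hc r
  -- Only `w + w'` matters for the counts. Per unit they give `(s + 5)(s + 2) = (k + 1)(k - 2)`
  -- vertices and `3(s + 5)(s + 1) = 3(k + 1)(k - 3)` edges.
  have en : 4 * m + 6 + (m + 1) * (w * (s + 2) + (s + 1)) + (m + 1) * (w' * (s + 2) + (s + 1)) +
      (m + 1) * s + r = (m + 1) * (s ^ 2 + 7 * s + 10) + 2 + r := by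
    have : 4 * m + 6 + (m + 1) * (w * (s + 2) + (s + 1)) + (m + 1) * (w' * (s + 2) + (s + 1)) +
      (m + 1) * s + r = (m + 1) * ((w + w') * (s + 2) + 3 * s + 6) + 2 + r := by ring
    rw [this, hw]
    ring
  have ee : 5 * (m + 1) + (m + 1) * (w * (3 * s + 3) + (3 * s + 2)) +
      (m + 1) * (w' * (3 * s + 3) + (3 * s + 2)) + (m + 1) * (3 * s) =
      (m + 1) * (3 * s ^ 2 + 18 * s + 15) := by
    have : 5 * (m + 1) + (m + 1) * (w * (3 * s + 3) + (3 * s + 2)) +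
      (m + 1) * (w' * (3 * s + 3) + (3 * s + 2)) + (m + 1) * (3 * s) =
      (m + 1) * ((w + w') * (3 * s + 3) + 9 * s + 9) := by ring
    rw [this, hw]
    ring
  rw [en, ee] at hF₄
  rw [en] at hpath
  refine ⟨T₄, P₄, B₃, W₂, L₂, by rw [hP₄, hP], hF₄, fun l => ?_, 0, a, hpath, hcyc⟩
  have hW₁ : ∀ l, l < 3 * (m + 1) → (∀ i < m + 1, l ≠ 3 * i + 2) → W₁ l ≤ 1 := by
    intro l hl hne
    have h3 : l % 3 ≠ 2 := fun h3 => hne (l / 3) (by omega) (by omega)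
    by_cases h1 : l % 3 = 1
    · have := hWl₁ (l / 3) (by omega)
      rwa [show 3 * (l / 3) + 1 = l by omega] at this
    · have h0 : l % 3 = 0 := by omega
      rw [(hkeep₁ l hl fun j _ => by omega).2]
      simp [unitWeight, hl, h0]
  by_cases hl₁ : L₁ ≤ l
  · exact hWge₂ l hl₁
  by_cases hl : ∃ i < m + 1, l = 3 * i + 2
  · obtain ⟨i, hi, rfl⟩ := hl
    exact hWl₂ i hi
  · push Not at hl
    rw [(hkeep₂ l (by omega) hl).2]
    by_cases hl' : l < 3 * (m + 1)
    · exact hW₁ l hl' hl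
    · exact hWge₁ l (by omega)

end PlanarAntiRamsey

/-! ### The coloring and the lower bound -/

namespace PlanarAntiRamsey

open SimpleGraph

/-- Every edge that avoids `P` has a color of its own, any other edge is colored by its largest end
in `P`. -/
def edgeColor (P : Finset ℕ) (a b : ℕ) : ℕ × ℕ :=
  if a ∈ P then if b ∈ P then (max a b, max a b) else (a, a)
  else if b ∈ P then (b, b) else (min a b, max a b)

theorem edgeColor_comm (P : Finset ℕ) (a b : ℕ) : edgeColor P a b = edgeColor P b a := by
  unfold edgeColor
  split_ifs <;> simp [max_comm, min_comm]

theorem edgeColor_of_le {P : Finset ℕ} {p b : ℕ} (hp : p ∈ P) (hb : b ∈ P → b ≤ p) :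
    edgeColor P p b = (p, p) := by
  unfold edgeColor
  split_ifs with h
  · rw [max_eq_left (hb h)]
  · rfl

theorem edgeColor_of_notMem {P : Finset ℕ} {a b : ℕ} (ha : a ∉ P) (hb : b ∉ P) (hab : a < b) :
    edgeColor P a b = (a, b) := by
  simp [edgeColor, ha, hb, min_eq_left hab.le, max_eq_right hab.le]

/-- The edge-coloring of the graph of a triangulation by `edgeColor`. -/
def coloring {n : ℕ} {T : Finset (ℕ × ℕ × ℕ)} (h : IsTriangulation n T) (P : Finset ℕ)
    (e : h.graph.edgeSet) : ℕ × ℕ :=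
  Sym2.lift ⟨fun a b : Fin n => edgeColor P a b, fun _ _ => edgeColor_comm _ _ _⟩ e.1

theorem cycleGraph_adj_succ {k i j : ℕ} (hi : i < k) (hj : j < k) (hk : 3 ≤ k)
    (h : j = i + 1 ∨ (i + 1 = k ∧ j = 0)) : (cycleGraph k).Adj ⟨i, hi⟩ ⟨j, hj⟩ := by
  rw [cycleGraph_adj']
  right
  rw [Fin.sub_def]
  dsimp only
  rcases h with rfl | ⟨h1, rfl⟩
  · rw [show k - i + (i + 1) = 1 + k by omega, Nat.add_mod_right, Nat.mod_eq_of_lt (by omega)]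
  · rw [show k - i + 0 = 1 by omega, Nat.mod_eq_of_lt (by omega)]

theorem eq_succ_of_cycleGraph_adj {k : ℕ} {i j : Fin k} (h : (cycleGraph k).Adj i j) :
    ((j : ℕ) = i + 1 ∨ ((i : ℕ) + 1 = k ∧ (j : ℕ) = 0)) ∨
      ((i : ℕ) = j + 1 ∨ ((j : ℕ) + 1 = k ∧ (i : ℕ) = 0)) := by
  have key : ∀ a b : Fin k, (a - b).val = 1 → (a : ℕ) = b + 1 ∨ ((b : ℕ) + 1 = k ∧ (a : ℕ) = 0) := by
    intro a b hab
    rw [Fin.sub_def] at hab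
    dsimp only at hab
    have ha := a.2
    have hb := b.2
    by_cases hlt : k - b + a < k
    · rw [Nat.mod_eq_of_lt hlt] at hab
      omega
    · rw [Nat.mod_eq_sub_mod (by omega), Nat.mod_eq_of_lt (by omega)] at hab
      omega
  rw [cycleGraph_adj'] at h
  rcases h with h | h
  · exact .inr (key _ _ h)
  · exact .inl (key _ _ h)

namespace Frame

variable {k n : ℕ} {T : Finset (ℕ × ℕ × ℕ)} {P : Finset ℕ} {B : ℕ → Finset ℕ} {W : ℕ → ℕ}
  {L e : ℕ}

/-- Pole-free edges have colors `(a, b)` with `a < b`, poles have colors on the diagonal, so the two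
kinds never coincide. -/
theorem card_range_coloring (h : Frame k n T P B W L e) :
    e + P.card ≤ Nat.card (Set.range (coloring h.tri P)) := by
  classical
  let S := T.filter fun t => t.1 < t.2.1 ∧ t.1 ∉ P ∧ t.2.1 ∉ P
  have hS : S.card = e := by
    rw [← h.edges]
    exact Finset.card_filter _ _
  let S' := S.image fun t => (t.1, t.2.1)
  have hS' : S'.card = e := by
    rw [← hS]
    refine Finset.card_image_of_injOn ?_
    rintro ⟨a, b, c⟩ ht ⟨a', b', c'⟩ ht' heq
    simp only [Prod.mk.injEq] at heq
    obtain ⟨rfl, rfl⟩ := heq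
    have h1 := (Finset.mem_filter.1 ht).1
    have h2 := (Finset.mem_filter.1 ht').1
    rw [h.tri.unique h1 h2]
  let Q := P.image fun p => (p, p)
  have hQ : Q.card = P.card := Finset.card_image_of_injective _ fun a b hab => by simpa using hab
  have hdisj : Disjoint S' Q := by
    rw [Finset.disjoint_left]
    intro t ht ht'
    obtain ⟨t₁, h1, rfl⟩ := Finset.mem_image.1 ht
    obtain ⟨p, -, h2⟩ := Finset.mem_image.1 ht'
    have h3 := (Finset.mem_filter.1 h1).2.1
    simp only [Prod.mk.injEq] at h2
    omega
  have hcard : ((S' ∪ Q : Finset (ℕ × ℕ)) : Set (ℕ × ℕ)).ncard = e + P.card := by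
    rw [Set.ncard_coe_finset, Finset.card_union_of_disjoint hdisj, hS', hQ]
  refine hcard.symm.le.trans ?_
  rw [Nat.card_coe_set_eq]
  refine Set.ncard_le_ncard ?_ (Set.finite_range _)
  intro t ht
  rcases Finset.mem_union.1 (Finset.mem_coe.1 ht) with ht | ht
  · obtain ⟨⟨a, b, c⟩, h1, rfl⟩ := Finset.mem_image.1 ht
    obtain ⟨h2, h3, h4, h5⟩ := Finset.mem_filter.1 h1
    refine ⟨⟨s(⟨a, h.tri.lt h2⟩, ⟨b, h.tri.lt₂ h2⟩), ⟨c, h2⟩⟩, ?_⟩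
    exact edgeColor_of_notMem h4 h5 h3
  · obtain ⟨p, hp, rfl⟩ := Finset.mem_image.1 ht
    obtain ⟨h1, a, c, h2, h3⟩ := h.pole p hp
    refine ⟨⟨s(⟨p, h1⟩, ⟨a, h.tri.lt₂ h2⟩), ⟨c, h2⟩⟩, ?_⟩
    exact edgeColor_of_le hp fun ha => (h3.resolve_left (not_not.2 ha)).le

/-- No copy of the cycle of length `k` is rainbow. -/
theorem not_injective_pullback (h : Frame k n T P B W L e) (hk : 3 ≤ k) (hW : ∀ l, W l ≤ 1)
    (f : Copy (cycleGraph k) h.tri.graph) :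
    ¬ Function.Injective (fun x => coloring h.tri P (f.toHom.mapEdgeSet x)) := by
  classical
  intro hinj
  have hk0 : 0 < k := by omega
  let c : ℕ → ℕ := fun i => f ⟨i % k, Nat.mod_lt _ hk0⟩
  have hcinj : ∀ i < k, ∀ j < k, c i = c j → i = j := by
    intro i hi j hj hij
    have h1 := f.injective (Fin.ext hij)
    simpa [Nat.mod_eq_of_lt hi, Nat.mod_eq_of_lt hj] using h1
  have hcyc : ∀ i, (cycleGraph k).Adj ⟨i % k, Nat.mod_lt _ hk0⟩ ⟨(i + 1) % k, Nat.mod_lt _ hk0⟩ := by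
    intro i
    refine cycleGraph_adj_succ _ _ hk ?_
    have h1 := Nat.mod_lt i hk0
    rw [← Nat.mod_add_mod]
    by_cases h2 : i % k + 1 = k
    · right
      exact ⟨h2, by rw [h2, Nat.mod_self]⟩
    · left
      exact Nat.mod_eq_of_lt (by omega)
  have hcol : ∀ i, coloring h.tri P (f.toHom.mapEdgeSet ⟨s(_, _), hcyc i⟩) =
      edgeColor P (c i) (c (i + 1)) := fun i => rfl
  -- Both cycle edges at the largest pole `p` of the cycle have the color `(p, p)`, and they are
  -- different edges since `k ≥ 3`.
  have hpole : ∀ i, c i ∉ P := by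
    by_contra! hex
    obtain ⟨i₀, hi₀⟩ := hex
    obtain ⟨p, ⟨hpP, i, hi⟩, hmax⟩ : ∃ p, (p ∈ P ∧ ∃ i, c i = p) ∧
        ∀ j, c j ∈ P → c j ≤ p := by
      have hne : (P.filter fun p => ∃ i, c i = p).Nonempty :=
        ⟨_, Finset.mem_filter.2 ⟨hi₀, i₀, rfl⟩⟩
      refine ⟨_, Finset.mem_filter.1 (Finset.max'_mem _ hne), fun j hj => ?_⟩
      exact Finset.le_max' _ _ (Finset.mem_filter.2 ⟨hj, j, rfl⟩)
    -- Shifting the index by the period provides a predecessor `j` in `ℕ` even when `i = 0`.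
    have hshift : c (i + k) = p := by
      rw [← hi]
      simp [c]
    obtain ⟨j, hj⟩ : ∃ j, i + k = j + 1 := ⟨i + k - 1, by omega⟩
    rw [hj] at hshift
    have e1 := hcol j
    have e2 := hcol (j + 1)
    rw [hshift, edgeColor_comm, edgeColor_of_le hpP (hmax j)] at e1
    rw [hshift, edgeColor_of_le hpP (hmax (j + 1 + 1))] at e2
    have heq := hinj (e1.trans e2.symm)
    replace heq := Sym2.eq_iff.1 (congrArg Subtype.val heq)
    simp only [Fin.mk.injEq] at heq
    have m1 : (j + 1) % k ≠ j % k := by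
      intro hm
      have := (Nat.modEq_iff_dvd' (by omega : j ≤ j + 1)).1 (Eq.symm hm : j % k = (j + 1) % k)
      rw [Nat.add_sub_cancel_left] at this
      have := Nat.le_of_dvd (by omega) this
      omega
    have m2 : (j + 1 + 1) % k ≠ j % k := by
      intro hm
      have := (Nat.modEq_iff_dvd' (by omega : j ≤ j + 1 + 1)).1
        (Eq.symm hm : j % k = (j + 1 + 1) % k)
      rw [show j + 1 + 1 - j = 2 by omega] at this
      have := Nat.le_of_dvd (by omega) this
      omega
    rcases heq with ⟨h1, -⟩ | ⟨h1, -⟩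
    · exact m1 h1.symm
    · exact m2 h1.symm
  refine h.spread.not_cycle hW h.small c (fun i hi j hj hij => hcinj i hi j hj hij) (by simp [c])
    fun i _ => ?_
  obtain ⟨d, hd⟩ := h.tri.graph_adj.1 (f.toHom.map_adj (hcyc i))
  exact h.cover hd (hpole i) (hpole (i + 1))

theorem isContained (h : Frame k n T P B W L e) (hk : 3 ≤ k) {u x d : ℕ}
    (hp : HasPath n T k u x) (hd : (x, u, d) ∈ T) : (cycleGraph k).IsContained h.tri.graph := by
  obtain ⟨c, h0, h1, hinj, hlt, hadj⟩ := hp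
  have key : ∀ i j : Fin k, ((j : ℕ) = i + 1 ∨ ((i : ℕ) + 1 = k ∧ (j : ℕ) = 0)) →
      h.tri.graph.Adj ⟨c i, hlt i i.2⟩ ⟨c j, hlt j j.2⟩ := by
    rintro i j (hij | ⟨hi, hj⟩)
    · obtain ⟨d', hd'⟩ := hadj i (by omega)
      exact ⟨d', by simpa [hij] using hd'⟩
    · refine ⟨d, ?_⟩
      have : (i : ℕ) = k - 1 := by omega
      simpa [this, hj, h0, h1] using hd
  refine ⟨⟨⟨fun i => ⟨c i, hlt i i.2⟩, ?_⟩, ?_⟩⟩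
  · intro i j hij
    rcases eq_succ_of_cycleGraph_adj hij with h2 | h2
    · exact key i j h2
    · exact (key j i h2).symm
  · intro i j hij
    exact Fin.ext (hinj i.2 j.2 (congrArg Fin.val hij))

theorem le_planarAntiRamsey (h : Frame k n T P B W L e) (hk : 3 ≤ k) (hW : ∀ l, W l ≤ 1)
    {u x d : ℕ} (hp : HasPath n T k u x) (hd : (x, u, d) ∈ T) :
    e + P.card ≤ planarAntiRamsey n (cycleGraph k) := by
  have hcont := h.isContained hk hp hd
  have hn : 3 ≤ n := by
    obtain ⟨f⟩ := hcont
    have := Fintype.card_le_of_injective f f.injective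
    simp only [Fintype.card_fin] at this
    omega
  refine h.card_range_coloring.trans (le_csSup (planarAntiRamseySet_bddAbove _ _) ?_)
  have : Finite (Set.range (coloring h.tri P)) := Set.finite_range _
  let φ := Finite.equivFin (Set.range (coloring h.tri P))
  refine ⟨h.tri.graph, h.tri.isPlaneTriangulation hn, hcont,
    fun x => φ (Set.rangeFactorization (coloring h.tri P) x),
    φ.surjective.comp Set.rangeFactorization_surjective, fun f hf => ?_⟩
  refine h.not_injective_pullback hk hW f fun x y hxy => hf ?_
  exact congrArg φ (Subtype.ext hxy)

end Frame

end PlanarAntiRamsey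

theorem theorem3p2 (k n r : ℕ) (hk : 5 ≤ k) (hn : k ^ 2 - k ≤ n)
    (hr : r = (n - 2) % (k ^ 2 - k - 2)) :
    (((k : ℝ) - 3) / ((k : ℝ) - 2) + 2 / (3 * ((k : ℝ) + 1) * ((k : ℝ) - 2))) * (3 * (n : ℝ) - 6)
        - (2 * (k : ℝ) ^ 2 - 5 * (k : ℝ) - 5) / ((k : ℝ) ^ 2 - (k : ℝ) - 2) * (r : ℝ)
      ≤ (SimpleGraph.planarAntiRamsey n (SimpleGraph.cycleGraph k) : ℝ) := by
  obtain ⟨s, rfl⟩ : ∃ s, k = s + 4 := ⟨k - 4, by omega⟩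
  have hD : (s + 4) ^ 2 - (s + 4) = s ^ 2 + 7 * s + 10 + 2 := by
    have : (s + 4) ^ 2 = s ^ 2 + 7 * s + 10 + 2 + (s + 4) := by ring
    omega
  rw [hD, Nat.add_sub_cancel] at hr
  rw [hD] at hn
  have hdiv := Nat.div_add_mod (n - 2) (s ^ 2 + 7 * s + 10)
  rw [← hr] at hdiv
  -- The hypothesis `n ≥ k² - k` says precisely that there is room for at least one unit.
  obtain ⟨m, hm⟩ : ∃ m, (n - 2) / (s ^ 2 + 7 * s + 10) = m + 1 :=
    ⟨(n - 2) / (s ^ 2 + 7 * s + 10) - 1, by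
      have := Nat.div_pos (show s ^ 2 + 7 * s + 10 ≤ n - 2 by omega) (by omega)
      omega⟩
  rw [hm] at hdiv
  have hn' : n = (m + 1) * (s ^ 2 + 7 * s + 10) + 2 + r := by
    rw [mul_comm] at hdiv
    omega
  obtain ⟨T, P, B, W, L, hP, hF, hW, u, a, hpath, c, hc⟩ :=
    PlanarAntiRamsey.exists_frame s m r
  rw [← hn'] at hF hpath
  have hle := hF.le_planarAntiRamsey (by omega) hW hpath hc
  rw [hP] at hle
  have hle' : (((m + 1) * (3 * s ^ 2 + 18 * s + 15) + (2 * (m + 1) + r) : ℕ) : ℝ) ≤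
      (SimpleGraph.planarAntiRamsey n (SimpleGraph.cycleGraph (s + 4)) : ℝ) := by
    exact_mod_cast hle
  -- The claimed bound equals the number of colors `(m + 1)(3(k + 1)(k - 3) + 2) + r`; the
  -- coefficient of `r` corrects the main term so that each leftover vertex counts for exactly one
  -- color.
  refine le_trans (le_of_eq ?_) hle'
  rw [hn']
  push_cast
  have h1 : (s : ℝ) + 4 - 2 = s + 2 := by ring
  have h2 : (s : ℝ) + 4 + 1 = s + 5 := by ring
  have h3 : ((s : ℝ) + 4) ^ 2 - (s + 4) - 2 = (s + 5) * (s + 2) := by ring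
  have h4 : (s : ℝ) + 2 ≠ 0 := by positivity
  have h5 : (s : ℝ) + 5 ≠ 0 := by positivity
  rw [h1, h2, h3]
  field_simp
  ring
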